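/- Consider the eigenvalue problem $-u''=\lambda u$ on $(-1,1)$, $u\in C^2[-1,1]$, $\lambda\in\mathbb R$, with a single-point condition at $-1$ and a multi-point condition at $1$: $$\alpha_0^-u(-1)+\beta_0^-u'(-1)=0,\qquad \alpha_0^+u(1)+\beta_0^+u'(1)=\sum_{i=1}^{m}\alpha_iu(\eta_i)+\sum_{i=1}^{m}\beta_iu'(\eta_i),$$ where $\alpha_0^\pm\ge0$, $\alpha_0^\pm+|\beta_0^\pm|>0$, $\pm\beta_0^\pm\ge0$, $\eta_i\in[-1,1)$, and $$\frac{\sum_i|\alpha_i|}{\alpha_0^+}+\frac{\sum_i|\beta_i|}{\beta_0^+}<1$$ (if a denominator is zero, the numerator must be zero and the fraction is omitted). An eigenfunction is a non-trivial solution. For an integer $k\ge0$, $S_k$ is the set of $u\in C^2[-1,1]$ with $u(\pm1)\ne0$ such that $u$ has exactly $k$ zeros in $(-1,1)$, all simple. $T_k$ is the set of $u\in C^2[-1,1]$ with $u'(\pm1)\ne0$ such that $u'$ has exactly $k$ zeros in $(-1,1)$, all simple, and $u$ has a zero strictly between any two consecutive zeros of $u'$. If $\beta_0^-=0$, the condition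 $u(-1)\neq0$ in the definition of $S_k$ is replaced by $u(-1)=0\ne u'(-1)$ (the zero at $-1$ is not counted). If $\alpha_0^-=0$, the condition $u'(-1)\ne0$ in the definition of $T_k$ is replaced by $u'(-1)=0$, and in the remaining conditions the interval $(-1,1)$ is replaced by $[-1,1)$ (the simple zero of $u'$ at $-1$ is counted). Let $\lambda_k^{RD}$ and $\lambda_k^{RN}$, $k\ge0$, be the eigenvalues, in increasing order, of $-u''=\lambda u$ with the above condition at $-1$ and the condition $u(1)=0$, respectively $u'(1)=0$, at $1$; set $\lambda_{-1}^{RD}:=0$. Let $J^+:=(\alpha_0^+/\beta_0^+)^2$, with $J^+:=\infty$ if $\beta_0^+=0$. Then the eigenvalues of the multi-point problem, and those of the two single-point problems just mentioned, each form a strictly increasing sequence tending to $\infty$, that of the multi-point problem being denoted by $\lambda_0<\lambda_1<\cdots$. There is a unique $k_c\in\{-1,0,1,\dots\}\cup\{\infty\}$ such that $\lambda_{k_c}^{RD}<J^+\le\lambda_{k_c+1}^{RD}$, where $k_c:=-1$ if $J^+=0$ and $k_c:=\infty$ if $J^+=\infty$. Let $\psi_k$ be any eigenfunction for $\lambda_k$.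 For every integer $k\ge0$: $$k\le k_c-1\implies\psi_k\in T_{k+1}\ \text{ and }\ \lambda_k^{RN}<\lambda_k<\lambda_{k+1}^{RN};$$ $$k\ge k_c+2\implies\psi_k\in S_k\ \text{ and }\ \lambda_{k-1}^{RD}<\lambda_k<\lambda_k^{RD}.$$ If $k_c=-1$, that is, if $J^+\le\lambda_0^{RD}$, then also $\psi_0\in S_0$ and $0\le\lambda_0<\lambda_0^{RD}$, where $\lambda_0=0$ if and only if $\alpha_0^-=\alpha_0^+=0$; hence $\psi_k\in S_k$ for all $k\ge0$. -/

import Mathlib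

open Set Filter Topology

noncomputable section

namespace MultiPoint

/-- The interval `[-1,1]`. -/
def I : Set ℝ := Icc (-1) 1

/-- The derivative `u'` of a function on `[-1,1]` (one-sided at the end points). -/
def D (u : ℝ → ℝ) : ℝ → ℝ := derivWithin u I

/-- `u ∈ C²[-1,1]`. -/
def IsC2 (u : ℝ → ℝ) : Prop := ContDiffOn ℝ 2 u I

/-- The data of a multi-point boundary condition
`a₀ u(e) + b₀ u'(e) = ∑ aᵢ u(ηᵢ) + ∑ bᵢ u'(ηᵢ)` at an end point `e`. -/
structure BC where
  m : ℕ
  a₀ : ℝ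
  b₀ : ℝ
  a : Fin m → ℝ
  b : Fin m → ℝ
  η : Fin m → ℝ

/-- The function `u` satisfies the boundary condition `c` at the end point `e`. -/
def BC.HoldsAt (c : BC) (e : ℝ) (u : ℝ → ℝ) : Prop :=
  c.a₀ * u e + c.b₀ * D u e = ∑ i, c.a i * u (c.η i) + ∑ i, c.b i * D u (c.η i)

/-- The single-point condition `a₀ u(e) + b₀ u'(e) = 0`. -/
def singlePoint (a₀ b₀ : ℝ) : BC where
  m := 0
  a₀ := a₀
  b₀ := b₀
  a := fun _ => 0
  b := fun _ => 0
  η := fun _ => 0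

def dirichlet : BC := singlePoint 1 0

def neumann : BC := singlePoint 0 1

/-- The standing assumptions on a boundary condition at the end point `e = 1` or `e = -1`:
the points `ηᵢ` lie in `[-1,1] \ {e}`, `a₀ ≥ 0`, `a₀ + |b₀| > 0`, and `e b₀ ≥ 0`. -/
structure BC.Admissible (c : BC) (e : ℝ) : Prop where
  mem : ∀ i, c.η i ∈ I
  ne : ∀ i, c.η i ≠ e
  nonneg : 0 ≤ c.a₀
  nondegenerate : 0 < c.a₀ + |c.b₀|
  sign : 0 ≤ e * c.b₀

/-- The condition `(∑ |aᵢ|) / a₀ + (∑ |bᵢ|) / b₀ < 1`, where a zero denominator requires the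
corresponding numerator to vanish, the fraction then being omitted (Lean's `0 / 0 = 0`). -/
def BC.StrongBound (c : BC) : Prop :=
  (c.a₀ = 0 → ∑ i, |c.a i| = 0) ∧ (c.b₀ = 0 → ∑ i, |c.b i| = 0) ∧
    (∑ i, |c.a i|) / c.a₀ + (∑ i, |c.b i|) / c.b₀ < 1

/-- `u` is an eigenfunction, with eigenvalue `lam`, of `-u'' = lam u` on `(-1,1)` with the boundary
conditions `l` at `-1` and `r` at `1`. -/
structure IsEigenfunction (l r : BC) (lam : ℝ) (u : ℝ → ℝ) : Prop where
  c2 : IsC2 u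
  eqn : ∀ x ∈ Ioo (-1 : ℝ) 1, -(D (D u) x) = lam * u x
  left : l.HoldsAt (-1) u
  right : r.HoldsAt 1 u
  nontrivial : ∃ x ∈ I, u x ≠ 0

/-- The set of (real) eigenvalues. -/
def spec (l r : BC) : Set ℝ := {lam | ∃ u, IsEigenfunction l r lam u}

/-- The `k`-th smallest element, `k = 0, 1, …`, of a set of reals. -/
def kth (σ : Set ℝ) : ℕ → ℝ
  | 0 => sInf σ
  | k + 1 => sInf {μ | μ ∈ σ ∧ kth σ k < μ}

/-- The `k`-th eigenvalue. -/
def eig (l r : BC) (k : ℕ) : ℝ := kth (spec l r) k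

/-- The spectrum is a strictly increasing sequence tending to infinity, listed by `eig`. -/
def SpectrumListed (l r : BC) : Prop :=
  StrictMono (eig l r) ∧ range (eig l r) = spec l r ∧ Tendsto (eig l r) atTop atTop

/-- Eigenvalues of the problem with the single-point part of `l` at `-1` and the Dirichlet
condition at `1`. -/
def eigRD (l : BC) (k : ℕ) : ℝ := eig (singlePoint l.a₀ l.b₀) dirichlet k

/-- The same with the Neumann condition at `1`. -/
def eigRN (l : BC) (k : ℕ) : ℝ := eig (singlePoint l.a₀ l.b₀) neumann k

/-- `eigRD`, indexed by the integers `n ≥ -1`, with value `0` at `n = -1`. -/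
def eigRDInt (l : BC) (n : ℤ) : ℝ := if n < 0 then 0 else eigRD l n.toNat

/-- `J = (a₀ / b₀)²`, and `J = ∞` if `b₀ = 0`. -/
def BC.J (c : BC) : EReal := if c.b₀ = 0 then ⊤ else (((c.a₀ / c.b₀) ^ 2 : ℝ) : EReal)

/-- `kc` is the index with `kc ≥ -1` and `λ_{kc}^{RD} < J ≤ λ_{kc+1}^{RD}`; it is `-1` if `J = 0`,
and `∞` if `J = ∞`. -/
def IsCriticalIndex (l r : BC) (kc : WithTop ℤ) : Prop :=
  (r.J = ⊤ ∧ kc = ⊤) ∨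
  (r.J = 0 ∧ kc = ((-1 : ℤ) : WithTop ℤ)) ∨
  (∃ n : ℤ, kc = (n : WithTop ℤ) ∧ -1 ≤ n ∧
    (eigRDInt l n : EReal) < r.J ∧ r.J ≤ (eigRDInt l (n + 1) : EReal))

/-- The zeros of `v` in `A` are simple, and there are exactly `k` of them. -/
def SimpleZeros (v : ℝ → ℝ) (A : Set ℝ) (k : ℕ) : Prop :=
  (∀ x ∈ A, v x = 0 → D v x ≠ 0) ∧ {x | x ∈ A ∧ v x = 0}.encard = k

/-- `u` has a zero strictly between any two consecutive zeros of `u'` in `A`. -/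
def ZeroBetween (u : ℝ → ℝ) (A : Set ℝ) : Prop :=
  ∀ x ∈ A, ∀ y ∈ A, x < y → D u x = 0 → D u y = 0 → (∀ z ∈ Ioo x y, D u z ≠ 0) →
    ∃ z ∈ Ioo x y, u z = 0

/-- The nodal set `S_k` (the union of its two halves `u(-1) > 0` and `u(-1) < 0`). -/
def S (k : ℕ) : Set (ℝ → ℝ) :=
  {u | IsC2 u ∧ u (-1) ≠ 0 ∧ u 1 ≠ 0 ∧ SimpleZeros u (Ioo (-1) 1) k}

/-- The nodal set `T_k` (the union of its two halves `u'(-1) > 0` and `u'(-1) < 0`). -/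
def T (k : ℕ) : Set (ℝ → ℝ) :=
  {u | IsC2 u ∧ D u (-1) ≠ 0 ∧ D u 1 ≠ 0 ∧ SimpleZeros (D u) (Ioo (-1) 1) k ∧
    ZeroBetween u (Ioo (-1) 1)}

/-- The variant of `S_k` for the Dirichlet condition `u(-1) = 0`; the simple zero at `-1` is not
counted. -/
def SDir (k : ℕ) : Set (ℝ → ℝ) :=
  {u | IsC2 u ∧ u (-1) = 0 ∧ D u (-1) ≠ 0 ∧ u 1 ≠ 0 ∧ SimpleZeros u (Ioo (-1) 1) k}

/-- The variant of `T_k` for the Neumann condition `u'(-1) = 0`; the simple zero of `u'` at `-1`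
is counted. -/
def TNeu (k : ℕ) : Set (ℝ → ℝ) :=
  {u | IsC2 u ∧ D u (-1) = 0 ∧ D u 1 ≠ 0 ∧ SimpleZeros (D u) (Ico (-1) 1) k ∧
    ZeroBetween u (Ico (-1) 1)}

/-- `S_k`, adapted to the single-point condition `a₀ u(-1) + b₀ u'(-1) = 0`. -/
def nodalS (l : BC) (k : ℕ) : Set (ℝ → ℝ) := {u | (l.b₀ = 0 ∧ u ∈ SDir k) ∨ (l.b₀ ≠ 0 ∧ u ∈ S k)}

/-- `T_k`, adapted to the single-point condition `a₀ u(-1) + b₀ u'(-1) = 0`. -/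
def nodalT (l : BC) (k : ℕ) : Set (ℝ → ℝ) := {u | (l.a₀ = 0 ∧ u ∈ TNeu k) ∨ (l.a₀ ≠ 0 ∧ u ∈ T k)}

end MultiPoint

end

noncomputable section

namespace MultiPoint

open Real

/-! ### Inequalities for pairs of weighted sums -/

/-! The proof is a phase-plane argument. No eigenvalue is negative: for `lam < 0` a solution obeying
the left condition and its derivative are, up to a common sign, nonnegative and nondecreasing, so
their weighted interior values cannot balance the right end point when the total relative weight is
below one (`monotone_pair`, `eigenvalue_nonneg`). For `lam = s²` with `s > 0` such a solution is a
multiple of sin(s(x+1) + θ(s)), where θ lies in [0, π/2] and is monotone in s. Writing the right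
coefficients as (P, Qs) = ρ(cos δ, sin δ) turns the right condition into `G s = 0`, where `G`
differs from sin Ψ, Ψ = 2s + θ + δ, by less than 1.

Since Ψ is strictly increasing and `G` has sign (-1)^k where Ψ = (k+1/2)π, each window (k+1/2)π < Ψ
< (k+3/2)π contains a root (for k = 0 possibly s = 0). At a positive root cos Ψ · G' > 0
(`hasDerivAt_G`, resting on the planar inequality `transversal`), so all crossings inside one window
have the same direction and there is only one. `Ps_gt_of_root` excludes positive roots before the
first window. Hence the eigenvalues are exactly the squares of the roots, one per window.

The nodal type is read off the end phase Φ = Ψ - δ. Dirichlet eigenvalues sit at Φ = (k+1)π and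
Neumann ones at Φ = (k+1/2)π. The window and 0 ≤ δ ≤ π/2 already give kπ < Φ < (k+3/2)π; what is
missing is Φ > (k+1/2)π for T_{k+1} or Φ < (k+1)π for S_k. The first holds for δ ≤ π/4, that is Qs ≤
P (`lt_Ph_of_le`), the second for δ ≥ π/4 (`Ph_lt_of_le`). The threshold Qs = P is s² = J, and the
automatic bounds on Φ place the root on the correct side of it when J is compared with a Dirichlet
eigenvalue. -/

theorem abs_mul_add_abs_mul_le_sqrt {X Y v w r : ℝ} (h : X ^ 2 + Y ^ 2 = 1) (hr : 0 ≤ r)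
    (hvw : v ^ 2 + w ^ 2 ≤ r ^ 2) : |X| * |v| + |Y| * |w| ≤ r := by
  apply abs_le_of_sq_le_sq' _ hr |>.2
  have h' : |X| ^ 2 + |Y| ^ 2 = 1 := by simpa only [sq_abs] using h
  have h'' : |v| ^ 2 + |w| ^ 2 ≤ r ^ 2 := by simpa only [sq_abs] using hvw
  nlinarith [sq_nonneg (|X| * |w| - |Y| * |v|)]

/-- Here (X, Y) is a rotated unit vector, and each summand pair is a rotation of (a xᵢ, b yᵢ), of
length at most |xᵢ| + |yᵢ|. If the first components dominated |X|, then pairing with (|X|, |Y|) and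
Cauchy–Schwarz would give 1 = X² + Y² ≤ ∑|xᵢ| + ∑|yᵢ| < 1. -/
theorem sum_abs_rotated_lt {m : ℕ} {a b c s : ℝ} {x y ci si : Fin m → ℝ}
    (ha : 0 ≤ a) (hb : 0 ≤ b) (hab : a ^ 2 + b ^ 2 = 1) (hcs : c ^ 2 + s ^ 2 = 1)
    (hcsi : ∀ i, ci i ^ 2 + si i ^ 2 = 1) (hxy : ∑ i, |x i| + ∑ i, |y i| < 1)
    (h0 : a * s + b * c = ∑ i, (a * x i * si i + b * y i * ci i)) :
    ∑ i, |a * x i * ci i - b * y i * si i| < |a * c - b * s| := by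
  by_contra! hle
  set X := a * c - b * s with hX
  set Y := a * s + b * c with hY
  have hXY : X ^ 2 + Y ^ 2 = 1 := by
    have : X ^ 2 + Y ^ 2 = (a ^ 2 + b ^ 2) * (c ^ 2 + s ^ 2) := by rw [hX, hY]; ring
    rw [this, hab, hcs, one_mul]
  have ha1 : a ≤ 1 := by nlinarith
  have hb1 : b ≤ 1 := by nlinarith
  have hYle : |Y| ≤ ∑ i, |a * x i * si i + b * y i * ci i| := by
    rw [h0]; exact Finset.abs_sum_le_sum_abs _ _
  have h1 : (1 : ℝ) ≤ |X| * ∑ i, |a * x i * ci i - b * y i * si i| +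
      |Y| * ∑ i, |a * x i * si i + b * y i * ci i| := by
    have e1 := mul_le_mul_of_nonneg_left hle (abs_nonneg X)
    have e2 := mul_le_mul_of_nonneg_left hYle (abs_nonneg Y)
    have e3 : |X| * |X| + |Y| * |Y| = 1 := by
      rw [abs_mul_abs_self, abs_mul_abs_self]; linarith
    linarith
  have h2 : ∀ i, |X| * |a * x i * ci i - b * y i * si i| +
      |Y| * |a * x i * si i + b * y i * ci i| ≤ |x i| + |y i| := by
    intro i
    have e1 : a * |x i| ≤ |x i| := mul_le_of_le_one_left (abs_nonneg _) ha1
    have e2 : b * |y i| ≤ |y i| := mul_le_of_le_one_left (abs_nonneg _) hb1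
    refine (abs_mul_add_abs_mul_le_sqrt hXY (r := a * |x i| + b * |y i|) (by positivity) ?_).trans
      (add_le_add e1 e2)
    have e3 : (a * x i * ci i - b * y i * si i) ^ 2 + (a * x i * si i + b * y i * ci i) ^ 2 =
        ((a * x i) ^ 2 + (b * y i) ^ 2) * (ci i ^ 2 + si i ^ 2) := by ring
    rw [e3, hcsi, mul_one]
    have e4 : 0 ≤ (a * |x i|) * (b * |y i|) := by positivity
    have e5 : (a * x i) ^ 2 = (a * |x i|) ^ 2 := by rw [mul_pow, mul_pow, sq_abs]
    have e6 : (b * y i) ^ 2 = (b * |y i|) ^ 2 := by rw [mul_pow, mul_pow, sq_abs]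
    rw [e5, e6]; nlinarith
  have h3 := Finset.sum_le_sum fun i (_ : i ∈ Finset.univ) => h2 i
  rw [Finset.sum_add_distrib, Finset.sum_add_distrib, ← Finset.mul_sum, ← Finset.mul_sum] at h3
  linarith

/-- The dichotomy behind the simplicity of eigenvalues, for non-negative `s` and `c`. -/
theorem le_or_le_of_same_sign {a b c s A B p q : ℝ} (ha : 0 ≤ a) (hb : 0 ≤ b)
    (hc : 0 ≤ c) (hs : 0 ≤ s) (hcs : c ^ 2 + s ^ 2 = 1) (hA : 0 ≤ A) (hB : 0 ≤ B)
    (hAB : A + B < 1) (hp : p ≤ A * a) (hq : q ≤ B * b) (h : a * s + b * c ≤ p + q)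
    (hX : b * s < a * c) : q ≤ b * c := by
  by_contra! hlt
  have hcB : b * c < b * B := by linarith
  have hb0 : 0 < b := lt_of_le_of_ne hb (by rintro rfl; simp at hcB)
  have hcB' : c < B := lt_of_mul_lt_mul_left hcB hb
  have ha0 : 0 < a := by
    rcases ha.eq_or_lt with h0 | h0
    · rw [← h0, zero_mul] at hX
      exact absurd hX (not_lt.2 (by positivity))
    · exact h0
  -- Multiplying by `s`, trading `b * s` for `a * c` and cancelling `a` leaves 1 = s² + c² ≤ A s + B
  -- c ≤ A + B < 1.
  have h1 : a * (s - A) ≤ b * (B - c) := by nlinarith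
  have h2 : b * s * (B - c) ≤ a * c * (B - c) :=
    mul_le_mul_of_nonneg_right hX.le (by linarith)
  have h3 : a * (s - A) * s ≤ b * (B - c) * s := mul_le_mul_of_nonneg_right h1 hs
  have h4 : a * ((s - A) * s) ≤ a * (c * (B - c)) := by nlinarith
  have h5 := le_of_mul_le_mul_left h4 ha0
  have hs1 : s ≤ 1 := by nlinarith
  have hc1 : c ≤ 1 := by nlinarith
  nlinarith [mul_le_mul_of_nonneg_left hs1 hA, mul_le_mul_of_nonneg_left hc1 hB]

/-- Argue by the quadrant of (c, s). With opposite signs, one quadrant contradicts `hX`; in the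
other, failure of both alternatives forces |c| < B and |s| < A, although |c| + |s| ≥ 1. The third
quadrant is the first one with the roles of (a, c, A, p) and (b, -s, B, q) exchanged. -/
theorem dichotomy {a b c s A B p q : ℝ} (ha : 0 ≤ a) (hb : 0 ≤ b)
    (hcs : c ^ 2 + s ^ 2 = 1) (hA : 0 ≤ A) (hB : 0 ≤ B)
    (hAB : A + B < 1) (hp : p ≤ A * a) (hq : q ≤ B * b) (h : |a * s + b * c| ≤ p + q)
    (hX : 0 < a * c - b * s) : q ≤ b * c ∨ p ≤ -(a * s) := by
  rcases le_total 0 c with hc | hc <;> rcases le_total 0 s with hs | hs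
  · left
    refine le_or_le_of_same_sign ha hb hc hs hcs hA hB hAB hp hq ((le_abs_self _).trans h)
      (by linarith)
  · by_contra! hh
    obtain ⟨h1, h2⟩ := hh
    have e1 : c < B := by
      by_contra! hle
      nlinarith [mul_le_mul_of_nonneg_left hle hb]
    have e2 : -s < A := by
      by_contra! hle
      nlinarith [mul_le_mul_of_nonneg_left hle ha]
    nlinarith
  · nlinarith [mul_nonneg ha (neg_nonneg.2 hc), mul_nonneg hb hs]
  · right
    have := le_or_le_of_same_sign (a := b) (b := a) (c := -s) (s := -c) (A := B) (B := A)
      (p := q) (q := p) hb ha (by linarith) (by linarith) (by nlinarith) hB hA (by linarith) hq hp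
      (by have := (neg_le_abs _).trans h; linarith) (by linarith)
    linarith

/-- The part weighted by τ is positive because the rotated sum is strictly dominated and 0 ≤ τᵢ ≤ τ.
The rest is nonnegative: by `h0` it can be written through the cosine terms or, with the opposite
sign, through the sine terms, and `dichotomy` makes one of the two forms visibly nonnegative. -/
theorem transversal_of_pos {m : ℕ} {a b c s τ : ℝ} {x y ci si τi : Fin m → ℝ}
    (ha : 0 ≤ a) (hb : 0 ≤ b) (hab : a ^ 2 + b ^ 2 = 1) (hcs : c ^ 2 + s ^ 2 = 1)
    (hcsi : ∀ i, ci i ^ 2 + si i ^ 2 = 1) (hxy : ∑ i, |x i| + ∑ i, |y i| < 1)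
    (hτ : 0 < τ) (hτi : ∀ i, 0 ≤ τi i) (hττ : ∀ i, τi i ≤ τ)
    (h0 : a * s + b * c = ∑ i, (a * x i * si i + b * y i * ci i)) (hX : 0 < a * c - b * s) :
    0 < τ * (a * c - b * s) - ∑ i, τi i * (a * x i * ci i - b * y i * si i) +
      (b * c - ∑ i, b * y i * ci i) := by
  have h1 := sum_abs_rotated_lt ha hb hab hcs hcsi hxy h0
  rw [abs_of_pos hX] at h1
  have hs1 : ∀ i, |si i| ≤ 1 := fun i => abs_le_one_iff_mul_self_le_one.2 (by nlinarith [hcsi i])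
  have hc1 : ∀ i, |ci i| ≤ 1 := fun i => abs_le_one_iff_mul_self_le_one.2 (by nlinarith [hcsi i])
  have h2 : ∑ i, τi i * (a * x i * ci i - b * y i * si i) ≤
      τ * ∑ i, |a * x i * ci i - b * y i * si i| := by
    rw [Finset.mul_sum]
    refine Finset.sum_le_sum fun i _ => ?_
    exact (mul_le_mul_of_nonneg_left (le_abs_self _) (hτi i)).trans
      (mul_le_mul_of_nonneg_right (hττ i) (abs_nonneg _))
  have h3 := mul_lt_mul_of_pos_left h1 hτ
  have hp : ∑ i, |a * x i * si i| ≤ (∑ i, |x i|) * a := by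
    rw [Finset.sum_mul]
    refine Finset.sum_le_sum fun i _ => ?_
    rw [abs_mul, abs_mul, abs_of_nonneg ha, mul_comm a]
    exact mul_le_of_le_one_right (by positivity) (hs1 i)
  have hq : ∑ i, |b * y i * ci i| ≤ (∑ i, |y i|) * b := by
    rw [Finset.sum_mul]
    refine Finset.sum_le_sum fun i _ => ?_
    rw [abs_mul, abs_mul, abs_of_nonneg hb, mul_comm b]
    exact mul_le_of_le_one_right (by positivity) (hc1 i)
  have hY : |a * s + b * c| ≤ ∑ i, |a * x i * si i| + ∑ i, |b * y i * ci i| := by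
    rw [h0, Finset.sum_add_distrib]
    exact (abs_add_le _ _).trans (add_le_add (Finset.abs_sum_le_sum_abs _ _)
      (Finset.abs_sum_le_sum_abs _ _))
  have hA : 0 ≤ ∑ i, |x i| := Finset.sum_nonneg fun _ _ => abs_nonneg _
  have hB : 0 ≤ ∑ i, |y i| := Finset.sum_nonneg fun _ _ => abs_nonneg _
  have hb' := (le_abs_self _).trans (Finset.abs_sum_le_sum_abs (fun i => b * y i * ci i) Finset.univ)
  have ha' := (neg_le_abs _).trans (Finset.abs_sum_le_sum_abs (fun i => a * x i * si i) Finset.univ)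
  rw [Finset.sum_add_distrib] at h0
  rcases dichotomy ha hb hcs hA hB hxy hp hq hY hX with h | h <;> linarith

theorem transversal {m : ℕ} {a b c s τ : ℝ} {x y ci si τi : Fin m → ℝ}
    (ha : 0 ≤ a) (hb : 0 ≤ b) (hab : a ^ 2 + b ^ 2 = 1) (hcs : c ^ 2 + s ^ 2 = 1)
    (hcsi : ∀ i, ci i ^ 2 + si i ^ 2 = 1) (hxy : ∑ i, |x i| + ∑ i, |y i| < 1)
    (hτ : 0 < τ) (hτi : ∀ i, 0 ≤ τi i) (hττ : ∀ i, τi i ≤ τ)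
    (h0 : a * s + b * c = ∑ i, (a * x i * si i + b * y i * ci i)) :
    0 < (a * c - b * s) * (τ * (a * c - b * s) -
      ∑ i, τi i * (a * x i * ci i - b * y i * si i) + (b * c - ∑ i, b * y i * ci i)) := by
  have h1 := sum_abs_rotated_lt ha hb hab hcs hcsi hxy h0
  have h2 : 0 < |a * c - b * s| :=
    (Finset.sum_nonneg fun _ _ => abs_nonneg _).trans_lt h1
  rcases lt_or_gt_of_ne (abs_pos.1 h2) with hX | hX
  -- Reflecting all vectors through the origin preserves the hypotheses and flips the sign of the
  -- first factor.
  · have := transversal_of_pos (c := -c) (s := -s) (ci := fun i => - ci i) (si := fun i => - si i)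
      ha hb hab (by simpa using hcs) (by simpa using hcsi) hxy hτ hτi hττ
      (by
        have : ∑ i, (a * x i * -si i + b * y i * -ci i) =
          -∑ i, (a * x i * si i + b * y i * ci i) := by
          rw [← Finset.sum_neg_distrib]; exact Finset.sum_congr rfl fun i _ => by ring
        rw [this, ← h0]; ring) (by linarith)
    have e1 : ∑ i, τi i * (a * x i * -ci i - b * y i * -si i) =
        -∑ i, τi i * (a * x i * ci i - b * y i * si i) := by
      rw [← Finset.sum_neg_distrib]; exact Finset.sum_congr rfl fun i _ => by ring
    have e2 : ∑ i, b * y i * -ci i = -∑ i, b * y i * ci i := by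
      rw [← Finset.sum_neg_distrib]; exact Finset.sum_congr rfl fun i _ => by ring
    rw [e1, e2] at this
    exact mul_pos_of_neg_of_neg hX (by linarith)
  · exact mul_pos hX (transversal_of_pos ha hb hab hcs hcsi hxy hτ hτi hττ h0 hX)

/-- If `s` and `c` have the same sign, a root cannot lie on the wrong side of the resonance. -/
theorem weighted_lt_of_le {a b c s A B : ℝ} (hb : 0 ≤ b) (ha0 : 0 < a)
    (hc : 0 ≤ c) (hs : 0 ≤ s) (hcs : c ^ 2 + s ^ 2 = 1) (hA : 0 ≤ A) (hB : 0 ≤ B)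
    (hAB : A + B < 1) (hba : b ≤ a) (h : a * c ≤ b * s) : A * a + B * b < a * s + b * c := by
  have hs1 : s ≤ 1 := by nlinarith
  have hc1 : c ≤ 1 := by nlinarith
  have hsc : 1 ≤ s + c := by nlinarith
  have hs0 : 0 < s := by
    rcases hs.eq_or_lt with h0 | h0
    · rw [← h0] at h hcs
      have : c = 0 := by nlinarith
      rw [this] at hcs; norm_num at hcs
    · exact h0
  have h1 : A * s + B * c < 1 := by
    nlinarith [mul_le_mul_of_nonneg_left hs1 hA, mul_le_mul_of_nonneg_left hc1 hB]
  -- For `B ≤ c`, multiply by `s` and use `a c ≤ b s`, then s² + c² = 1. For `c ≤ B`, use `b ≤ a`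
  -- and s + c ≥ 1.
  rcases le_total B c with hBc | hBc
  · have e1 : a * c * (c - B) ≤ b * s * (c - B) := mul_le_mul_of_nonneg_right h (by linarith)
    have e2 : 0 < a * (1 - (A * s + B * c)) := mul_pos ha0 (by linarith)
    have e3 : 0 < s * (a * (s - A) + b * (c - B)) := by nlinarith
    have := (mul_pos_iff_of_pos_left hs0).1 e3
    nlinarith
  · have e1 : b * (B - c) ≤ a * (B - c) := mul_le_mul_of_nonneg_right hba (by linarith)
    nlinarith

/-! ### The phase functions -/

/-- The angle in `[0, π/2]` with tangent `q s / p`. -/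
def ang (p q s : ℝ) : ℝ := if p = 0 then π / 2 else arctan (q * s / p)

theorem ang_nonneg {p q s : ℝ} (hp : 0 ≤ p) (hq : 0 ≤ q) (hs : 0 ≤ s) : 0 ≤ ang p q s := by
  unfold ang; split_ifs
  · positivity
  · exact arctan_nonneg.2 (by positivity)

theorem ang_le (p q s : ℝ) : ang p q s ≤ π / 2 := by
  unfold ang; split_ifs
  · exact le_rfl
  · exact (arctan_lt_pi_div_two _).le

theorem ang_lt {p : ℝ} (hp : p ≠ 0) (q s : ℝ) : ang p q s < π / 2 := by
  rw [ang, if_neg hp]; exact arctan_lt_pi_div_two _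

theorem ang_zero_right {p : ℝ} (hp : p ≠ 0) (q : ℝ) : ang p q 0 = 0 := by
  simp [ang, hp]

@[simp] theorem ang_zero_left (q s : ℝ) : ang 0 q s = π / 2 := by simp [ang]

theorem ang_pos {p q s : ℝ} (hp : 0 ≤ p) (hq : 0 < q) (hs : 0 < s) : 0 < ang p q s := by
  unfold ang; split_ifs with h
  · positivity
  · have : 0 < p := lt_of_le_of_ne hp (Ne.symm h)
    exact arctan_pos.2 (by positivity)

theorem ang_monotone {p q : ℝ} (hp : 0 ≤ p) (hq : 0 ≤ q) : Monotone (ang p q) := by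
  intro s t hst
  unfold ang; split_ifs
  · exact le_rfl
  · refine arctan_strictMono.monotone ?_
    gcongr

theorem cos_ang_nonneg {p q s : ℝ} (hp : 0 ≤ p) (hq : 0 ≤ q) (hs : 0 ≤ s) :
    0 ≤ cos (ang p q s) :=
  cos_nonneg_of_mem_Icc ⟨by linarith [ang_nonneg hp hq hs, pi_pos], ang_le _ _ _⟩

theorem sin_ang_nonneg {p q s : ℝ} (hp : 0 ≤ p) (hq : 0 ≤ q) (hs : 0 ≤ s) :
    0 ≤ sin (ang p q s) :=
  sin_nonneg_of_nonneg_of_le_pi (ang_nonneg hp hq hs) (by linarith [ang_le p q s, pi_pos])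

theorem mul_sin_ang (p q s : ℝ) : p * sin (ang p q s) = q * s * cos (ang p q s) := by
  unfold ang; split_ifs with h
  · simp [h]
  · have h1 := cos_arctan_pos (q * s / p)
    have h2 := tan_arctan (q * s / p)
    rw [tan_eq_sin_div_cos, div_eq_iff h1.ne'] at h2
    rw [h2]; field_simp

/-- Polar coordinates of (p, q s); for `s > 0` the pair does not vanish, so dividing a boundary
condition by the modulus loses nothing. -/
theorem exists_modulus {p q s : ℝ} (hp : 0 ≤ p) (hq : 0 ≤ q) (hpq : 0 < p + q) (hs : 0 < s) :
    ∃ ρ, 0 < ρ ∧ p = ρ * cos (ang p q s) ∧ q * s = ρ * sin (ang p q s) := by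
  have h := mul_sin_ang p q s
  have h1 := sin_sq_add_cos_sq (ang p q s)
  have e1 : p = (p * cos (ang p q s) + q * s * sin (ang p q s)) * cos (ang p q s) := by
    linear_combination (-p) * h1 + sin (ang p q s) * h
  have e2 : q * s = (p * cos (ang p q s) + q * s * sin (ang p q s)) * sin (ang p q s) := by
    linear_combination (-(q * s)) * h1 - cos (ang p q s) * h
  refine ⟨_, ?_, e1, e2⟩
  have h2 := cos_ang_nonneg hp hq hs.le
  have h3 := sin_ang_nonneg hp hq hs.le
  refine lt_of_le_of_ne (by positivity) fun h0 => ?_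
  rw [← h0, zero_mul] at e1 e2
  have : q = 0 := (mul_eq_zero.1 e2).resolve_right hs.ne'
  linarith

/-- The relation `s * t = sin * cos` is the form of the derivative that also covers `p = 0`, where
the angle is constantly π/2 and both sides vanish. -/
theorem hasDerivAt_ang (p q s : ℝ) : ∃ t, HasDerivAt (ang p q) t s ∧
    s * t = sin (ang p q s) * cos (ang p q s) := by
  by_cases h : p = 0
  · subst h
    refine ⟨0, ?_, by simp⟩
    have : ang 0 q = fun _ => π / 2 := by ext; simp
    rw [this]; exact hasDerivAt_const _ _
  · have h0 : ang p q = fun s => arctan (q * s / p) := by ext; simp [ang, h]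
    have h1 : HasDerivAt (fun s : ℝ => q * s / p) (q / p) s := by
      simpa using ((hasDerivAt_id s).const_mul q).div_const p
    refine ⟨_, by rw [h0]; exact h1.arctan, ?_⟩
    have h2 := mul_sin_ang p q s
    have h3 : cos (ang p q s) ^ 2 = 1 / (1 + (q * s / p) ^ 2) := by
      rw [h0]; exact cos_sq_arctan _
    rw [← h3]
    have h4 : sin (ang p q s) = q * s * cos (ang p q s) / p := by
      rw [eq_div_iff h, mul_comm, h2]
    rw [h4]; ring

theorem continuous_ang (p q : ℝ) : Continuous (ang p q) :=
  continuous_iff_continuousAt.2 fun s =>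
    let ⟨_, h, _⟩ := hasDerivAt_ang p q s
    h.continuousAt

/-- After the first zero the function can never become negative, yet a positive derivative at the
second zero makes it negative just to the left. -/
theorem not_two_zeros_of_deriv_pos {f f' : ℝ → ℝ} {u v : ℝ} (huv : u < v)
    (hf : ∀ t ∈ Icc u v, HasDerivAt f (f' t) t) (hu : f u = 0) (hv : f v = 0)
    (hpos : ∀ t ∈ Icc u v, f t = 0 → 0 < f' t) : False := by
  have h0 : ∀ ⦃t⦄, t ∈ Icc u v → (0 : ℝ) ≤ f t := by
    refine image_le_of_deriv_right_lt_deriv_boundary' (f := fun _ => (0 : ℝ)) (f' := fun _ => 0)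
      (B' := f') continuousOn_const (fun t _ => hasDerivWithinAt_const _ _ _) hu.ge
      (fun t ht => (hf t ht).continuousAt.continuousWithinAt)
      (fun t ht => (hf t ⟨ht.1, ht.2.le⟩).hasDerivWithinAt)
      (fun t ht h => hpos t ⟨ht.1, ht.2.le⟩ h.symm)
  have hv' : v ∈ Icc u v := right_mem_Icc.2 huv.le
  have h1 : ∀ᶠ t in 𝓝[<] v, 0 < slope f v t :=
    ((hasDerivAt_iff_tendsto_slope.1 (hf v hv')).mono_left
      (nhdsWithin_mono _ fun t (ht : t < v) => ht.ne)).eventually_const_lt (hpos v hv' hv)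
  obtain ⟨t, ht, htu, htv⟩ := (h1.and (Ioo_mem_nhdsLT huv)).exists
  rw [slope_def_field, hv, sub_zero] at ht
  have := h0 ⟨htu.le, htv.le⟩
  have h2 : f t / (t - v) ≤ 0 := div_nonpos_of_nonneg_of_nonpos this (by linarith)
  linarith

/-- The (normalised) data of the characteristic function of a multi-point problem: the left
condition is `p u(-1) = q u'(-1)`, the right condition is
`P (u(1) - ∑ xᵢ u(ξᵢ - 1)) + Q (u'(1) - ∑ yᵢ u'(ξᵢ - 1)) = 0`. -/
structure CharData (m : ℕ) where
  p : ℝ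
  q : ℝ
  P : ℝ
  Q : ℝ
  x : Fin m → ℝ
  y : Fin m → ℝ
  ξ : Fin m → ℝ
  hp : 0 ≤ p
  hq : 0 ≤ q
  hpq : 0 < p + q
  hP : 0 ≤ P
  hQ : 0 ≤ Q
  hPQ : 0 < P + Q
  hξ0 : ∀ i, 0 ≤ ξ i
  hξ2 : ∀ i, ξ i ≤ 2
  hxy : ∑ i, |x i| + ∑ i, |y i| < 1

namespace CharData

variable {m : ℕ} (d : CharData m)

/-- The initial phase. -/
def th (s : ℝ) : ℝ := ang d.p d.q s

/-- The phase of the right boundary condition. -/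
def de (s : ℝ) : ℝ := ang d.P d.Q s

/-- The phase at the right end point. -/
def Ph (s : ℝ) : ℝ := s * 2 + d.th s

/-- The total phase. -/
def Ps (s : ℝ) : ℝ := d.Ph s + d.de s

/-- The phase at the point `ξᵢ`. -/
def ph (i : Fin m) (s : ℝ) : ℝ := s * d.ξ i + d.th s

/-- The normalised characteristic function. -/
def G (s : ℝ) : ℝ := sin (d.Ps s) - ∑ i, (cos (d.de s) * d.x i * sin (d.ph i s) +
  sin (d.de s) * d.y i * cos (d.ph i s))

/-- The range of the total phase that contains the root number `k`. -/
def window (k : ℕ) : Set ℝ := Ioo ((k + 1 / 2) * π) ((k + 3 / 2) * π)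

theorem th_nonneg {s : ℝ} (hs : 0 ≤ s) : 0 ≤ d.th s := ang_nonneg d.hp d.hq hs

theorem de_nonneg {s : ℝ} (hs : 0 ≤ s) : 0 ≤ d.de s := ang_nonneg d.hP d.hQ hs

theorem th_le (s : ℝ) : d.th s ≤ π / 2 := ang_le _ _ _

theorem de_le (s : ℝ) : d.de s ≤ π / 2 := ang_le _ _ _

theorem Ph_strictMono : StrictMono d.Ph := fun s t h => by
  have := ang_monotone d.hp d.hq h.le
  unfold Ph th; linarith

theorem Ps_strictMono : StrictMono d.Ps := fun _ _ h =>
  add_lt_add_of_lt_of_le (d.Ph_strictMono h) (ang_monotone d.hP d.hQ h.le)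

theorem continuous_th : Continuous d.th := continuous_ang _ _

theorem continuous_de : Continuous d.de := continuous_ang _ _

theorem continuous_Ps : Continuous d.Ps := by
  unfold Ps Ph
  have := d.continuous_th
  have := d.continuous_de
  fun_prop

theorem continuous_G : Continuous d.G := by
  unfold G ph
  have := d.continuous_th
  have := d.continuous_de
  have := d.continuous_Ps
  fun_prop

theorem sum_abs_nonneg (x : Fin m → ℝ) : 0 ≤ ∑ i, |x i| :=
  Finset.sum_nonneg fun _ _ => abs_nonneg _

theorem abs_sin_Ps_sub_G_le {s : ℝ} (hs : 0 ≤ s) : |sin (d.Ps s) - d.G s| ≤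
    (∑ i, |d.x i|) * cos (d.de s) + (∑ i, |d.y i|) * sin (d.de s) := by
  have ha : 0 ≤ cos (d.de s) := cos_ang_nonneg d.hP d.hQ hs
  have hb : 0 ≤ sin (d.de s) := sin_ang_nonneg d.hP d.hQ hs
  rw [G, sub_sub_cancel, Finset.sum_mul, Finset.sum_mul, ← Finset.sum_add_distrib]
  refine (Finset.abs_sum_le_sum_abs _ _).trans (Finset.sum_le_sum fun i _ => ?_)
  refine (abs_add_le _ _).trans (add_le_add ?_ ?_)
  · rw [abs_mul, abs_mul, abs_of_nonneg ha, mul_comm (cos _)]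
    exact mul_le_of_le_one_right (by positivity) (abs_sin_le_one _)
  · rw [abs_mul, abs_mul, abs_of_nonneg hb, mul_comm (sin _)]
    exact mul_le_of_le_one_right (by positivity) (abs_cos_le_one _)

theorem abs_sin_Ps_sub_G_lt {s : ℝ} (hs : 0 ≤ s) : |sin (d.Ps s) - d.G s| < 1 := by
  have h1 := mul_le_of_le_one_right (sum_abs_nonneg d.x) (cos_le_one (d.de s))
  have h2 := mul_le_of_le_one_right (sum_abs_nonneg d.y) (sin_le_one (d.de s))
  linarith [d.abs_sin_Ps_sub_G_le hs, d.hxy]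

/-! ### Transversality and uniqueness of roots within a window. -/

/-- At a root, s · G' is exactly the second factor in `transversal`, whose first factor is cos Ψ.
The equation `G s = 0` is what collapses the terms coming from the derivative of δ into cosine terms
alone. -/
theorem hasDerivAt_G {s : ℝ} (hs : 0 < s) : ∃ g, HasDerivAt d.G g s ∧
    (d.G s = 0 → 0 < cos (d.Ps s) * g) := by
  obtain ⟨t1, ht1, h1⟩ := hasDerivAt_ang d.p d.q s
  obtain ⟨t2, ht2, h2⟩ := hasDerivAt_ang d.P d.Q s
  change HasDerivAt d.th t1 s at ht1
  change HasDerivAt d.de t2 s at ht2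
  change s * t1 = sin (d.th s) * cos (d.th s) at h1
  change s * t2 = sin (d.de s) * cos (d.de s) at h2
  have hPh : HasDerivAt d.Ph (2 + t1) s := by
    have := ((hasDerivAt_id s).mul_const 2).add ht1
    rw [one_mul] at this; exact this
  have hPs : HasDerivAt d.Ps (2 + t1 + t2) s := hPh.add ht2
  have hph : ∀ i, HasDerivAt (d.ph i) (d.ξ i + t1) s := fun i => by
    have := ((hasDerivAt_id s).mul_const (d.ξ i)).add ht1
    rw [one_mul] at this; exact this
  have hG : HasDerivAt d.G (cos (d.Ps s) * (2 + t1 + t2) - ∑ i,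
      ((-sin (d.de s) * t2 * d.x i) * sin (d.ph i s) +
        (cos (d.de s) * d.x i) * (cos (d.ph i s) * (d.ξ i + t1)) +
      ((cos (d.de s) * t2 * d.y i) * cos (d.ph i s) +
        (sin (d.de s) * d.y i) * (-sin (d.ph i s) * (d.ξ i + t1))))) s :=
    hPs.sin.sub (HasDerivAt.fun_sum fun i _ =>
      ((ht2.cos.mul_const (d.x i)).mul (hph i).sin).add
        ((ht2.sin.mul_const (d.y i)).mul (hph i).cos))
  refine ⟨_, hG, fun h0 => ?_⟩
  have hab := cos_sq_add_sin_sq (d.de s)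
  have e0 : 0 ≤ sin (d.th s) * cos (d.th s) :=
    mul_nonneg (sin_ang_nonneg d.hp d.hq hs.le) (cos_ang_nonneg d.hp d.hq hs.le)
  have e1 : sin (d.Ps s) = cos (d.de s) * sin (d.Ph s) + sin (d.de s) * cos (d.Ph s) := by
    rw [Ps, sin_add]; ring
  have e2 : cos (d.Ps s) = cos (d.de s) * cos (d.Ph s) - sin (d.de s) * sin (d.Ph s) := by
    rw [Ps, cos_add]; ring
  have h0' : cos (d.de s) * sin (d.Ph s) + sin (d.de s) * cos (d.Ph s) =
      ∑ i, (cos (d.de s) * d.x i * sin (d.ph i s) + sin (d.de s) * d.y i * cos (d.ph i s)) := by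
    rw [← e1]; exact sub_eq_zero.1 h0
  -- The weights are s times the derivatives of the phases at the right end point and at the
  -- interior points; `ξᵢ ≤ 2` gives τᵢ ≤ τ.
  have key := transversal (τ := s * (2 + t1)) (τi := fun i => s * (d.ξ i + t1))
    (x := d.x) (y := d.y) (ci := fun i => cos (d.ph i s)) (si := fun i => sin (d.ph i s))
    (cos_ang_nonneg d.hP d.hQ hs.le) (sin_ang_nonneg d.hP d.hQ hs.le) hab
    (cos_sq_add_sin_sq (d.Ph s)) (fun i => cos_sq_add_sin_sq _) d.hxy (by nlinarith)
    (fun i => by nlinarith [mul_nonneg hs.le (d.hξ0 i)])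
    (fun i => mul_le_mul_of_nonneg_left (by linarith [d.hξ2 i]) hs.le) h0'
  rw [show ang d.P d.Q s = d.de s from rfl] at key
  rw [← e2] at key
  rw [Finset.sum_add_distrib] at h0'
  have e3 : s * ∑ i, ((-sin (d.de s) * t2 * d.x i) * sin (d.ph i s) +
        (cos (d.de s) * d.x i) * (cos (d.ph i s) * (d.ξ i + t1)) +
      ((cos (d.de s) * t2 * d.y i) * cos (d.ph i s) +
        (sin (d.de s) * d.y i) * (-sin (d.ph i s) * (d.ξ i + t1)))) =
      ∑ i, s * (d.ξ i + t1) * (cos (d.de s) * d.x i * cos (d.ph i s) -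
        sin (d.de s) * d.y i * sin (d.ph i s))
      - sin (d.de s) ^ 2 * ∑ i, cos (d.de s) * d.x i * sin (d.ph i s)
      + cos (d.de s) ^ 2 * ∑ i, sin (d.de s) * d.y i * cos (d.ph i s) := by
    rw [Finset.mul_sum, Finset.mul_sum, Finset.mul_sum, ← Finset.sum_sub_distrib,
      ← Finset.sum_add_distrib]
    refine Finset.sum_congr rfl fun i _ => ?_
    linear_combination (cos (d.de s) * d.y i * cos (d.ph i s) -
      sin (d.de s) * d.x i * sin (d.ph i s)) * h2
  refine (mul_pos_iff_of_pos_left hs).1 ?_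
  refine key.trans_eq ?_
  set U := ∑ i, cos (d.de s) * d.x i * sin (d.ph i s)
  set V := ∑ i, sin (d.de s) * d.y i * cos (d.ph i s)
  set W := ∑ i, s * (d.ξ i + t1) * (cos (d.de s) * d.x i * cos (d.ph i s) -
        sin (d.de s) * d.y i * sin (d.ph i s))
  rw [mul_left_comm, mul_sub, e3]
  congr 1
  have e4 : s * (cos (d.Ps s) * (2 + t1 + t2)) = s * (2 + t1) * cos (d.Ps s) +
    sin (d.de s) * cos (d.de s) * cos (d.Ps s) := by linear_combination cos (d.Ps s) * h2
  rw [e4]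
  linear_combination (-sin (d.de s) * cos (d.de s)) * e2 + sin (d.de s) ^ 2 * h0' +
    (V - sin (d.de s) * cos (d.Ph s)) * hab

theorem cos_window_pos {k : ℕ} {r : ℝ} (hr : r ∈ window k) : 0 < (-1) ^ (k + 1) * cos r := by
  rw [← cos_sub_nat_mul_pi]
  refine cos_pos_of_mem_Ioo ⟨?_, ?_⟩ <;> push_cast <;> linarith [hr.1, hr.2]

theorem root_unique_of_pos {k : ℕ} {s t : ℝ} (hs : 0 < s) (hst : s < t) (hGs : d.G s = 0)
    (hGt : d.G t = 0) (hs' : d.Ps s ∈ window k) (ht' : d.Ps t ∈ window k) : False := by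
  choose! g hg hg' using fun (r : ℝ) (hr : r ∈ Icc s t) => d.hasDerivAt_G (hs.trans_le hr.1)
  -- On this window cos Ψ has the sign (-1)^(k+1), so after multiplication by it every zero of `G`
  -- is an upward crossing.
  refine not_two_zeros_of_deriv_pos (f := fun r => (-1) ^ (k + 1) * d.G r)
    (f' := fun r => (-1) ^ (k + 1) * g r) hst (fun r hr => (hg r hr).const_mul _)
    (by simp [hGs]) (by simp [hGt]) fun r hr h0 => ?_
  have h0' : d.G r = 0 := by simpa using h0
  have h1 : d.Ps r ∈ window k := ⟨hs'.1.trans_le (d.Ps_strictMono.monotone hr.1),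
    (d.Ps_strictMono.monotone hr.2).trans_lt ht'.2⟩
  have h2 := cos_window_pos h1
  have h3 := hg' r hr h0'
  have h4 : ((-1 : ℝ) ^ (k + 1)) * (-1) ^ (k + 1) = 1 := by
    rw [← mul_pow]; norm_num
  have h5 : ((-1) ^ (k + 1) * cos (d.Ps r)) * ((-1) ^ (k + 1) * g r) = cos (d.Ps r) * g r := by
    linear_combination (cos (d.Ps r) * g r) * h4
  rw [← h5] at h3
  exact (mul_pos_iff_of_pos_left h2).1 h3

theorem Ps_zero_of_eq (hp : d.p = 0) (hP : d.P = 0) (s : ℝ) : d.Ps s = s * 2 + π := by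
  simp [Ps, Ph, th, de, hp, hP]; ring

/-- This confines the root s = 0 to the doubly Neumann-like case p = P = 0, in which Ψ(0) = π lies
in window 0; otherwise at least one of the two phases vanishes at 0. -/
theorem Ps_zero_le (h : ¬(d.p = 0 ∧ d.P = 0)) : d.Ps 0 ≤ π / 2 := by
  rw [not_and_or] at h
  unfold Ps Ph th de
  rcases h with h | h
  · rw [ang_zero_right h]; linarith [ang_le d.P d.Q 0]
  · rw [ang_zero_right h]; linarith [ang_le d.p d.q 0]

theorem eq_zero_of_root_zero {k : ℕ} (h : d.Ps 0 ∈ window k) :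
    k = 0 ∧ d.p = 0 ∧ d.P = 0 := by
  have h1 := h.1
  have hk : (0 : ℝ) ≤ k := k.cast_nonneg
  have h2 : d.p = 0 ∧ d.P = 0 := by
    by_contra hn
    have := d.Ps_zero_le hn
    nlinarith [pi_pos]
  refine ⟨?_, h2⟩
  rw [d.Ps_zero_of_eq h2.1 h2.2] at h1
  by_contra hk0
  have : (1 : ℝ) ≤ k := by exact_mod_cast Nat.one_le_iff_ne_zero.2 hk0
  nlinarith [pi_pos]

theorem G_zero (hp : d.p = 0) (hP : d.P = 0) : d.G 0 = 0 := by
  simp [G, Ps, Ph, th, de, ph, hp, hP]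

theorem root_unique {k : ℕ} {s t : ℝ} (hs : 0 ≤ s) (hst : s < t) (hGs : d.G s = 0)
    (hGt : d.G t = 0) (hs' : d.Ps s ∈ window k) (ht' : d.Ps t ∈ window k) : False := by
  rcases hs.eq_or_lt with rfl | hs0
  -- Transversality is only available for s > 0. At the root s = 0, `G` reduces to an explicit sine
  -- expression, negative while 0 < 2t < π/2 because sin is increasing there and the weights sum to
  -- less than one.
  · obtain ⟨rfl, hp, hP⟩ := d.eq_zero_of_root_zero hs'
    have h1 := ht'.2
    rw [d.Ps_zero_of_eq hp hP] at h1
    push_cast at h1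
    have h2 : d.G t = -sin (t * 2) + ∑ i, d.y i * sin (t * d.ξ i) := by
      rw [G, d.Ps_zero_of_eq hp hP, sin_add_pi, sub_eq_add_neg, ← Finset.sum_neg_distrib]
      simp [de, ph, th, hp, hP, cos_add_pi_div_two]
    have h3 : 0 < sin (t * 2) := sin_pos_of_pos_of_lt_pi (by linarith) (by linarith [pi_pos])
    have h4 : ∑ i, d.y i * sin (t * d.ξ i) ≤ (∑ i, |d.y i|) * sin (t * 2) := by
      rw [Finset.sum_mul]
      refine Finset.sum_le_sum fun i _ => (le_abs_self _).trans ?_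
      rw [abs_mul]
      have e1 : 0 ≤ t * d.ξ i := mul_nonneg hst.le (d.hξ0 i)
      have e2 : t * d.ξ i ≤ t * 2 := mul_le_mul_of_nonneg_left (d.hξ2 i) hst.le
      rw [abs_of_nonneg (sin_nonneg_of_nonneg_of_le_pi e1 (by linarith [pi_pos]))]
      exact mul_le_mul_of_nonneg_left (sin_le_sin_of_le_of_le_pi_div_two
        (by linarith [pi_pos]) (by linarith) e2) (abs_nonneg _)
    have h5 := d.hxy
    have h6 := sum_abs_nonneg d.x
    nlinarith
  · exact d.root_unique_of_pos hs0 hst hGs hGt hs' ht'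

/-! ### Existence of a root in every window. -/

theorem exists_Ps_eq {r : ℝ} (hr : d.Ps 0 ≤ r) : ∃ s, 0 ≤ s ∧ d.Ps s = r := by
  have h1 : r ≤ d.Ps |r| := by
    have := d.th_nonneg (abs_nonneg r)
    have := d.de_nonneg (abs_nonneg r)
    have := le_abs_self r
    unfold Ps Ph; linarith [abs_nonneg r]
  obtain ⟨s, hs, h⟩ := intermediate_value_Icc (abs_nonneg r) d.continuous_Ps.continuousOn ⟨hr, h1⟩
  exact ⟨s, hs.1, h⟩

theorem sign_G_of_Ps_eq {k : ℕ} {s : ℝ} (hs : 0 ≤ s) (h : d.Ps s = (k + 1 / 2) * π) :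
    0 < (-1) ^ k * d.G s := by
  have h1 := d.abs_sin_Ps_sub_G_lt hs
  have h2 : sin (d.Ps s) = (-1) ^ k := by
    rw [h, show (k + 1 / 2 : ℝ) * π = π / 2 + k * π by ring, sin_add_nat_mul_pi]; simp
  rw [h2, abs_lt] at h1
  rcases neg_one_pow_eq_or ℝ k with e | e <;> rw [e] at h1 ⊢ <;> linarith [h1.1, h1.2]

theorem exists_root (k : ℕ) : ∃ s, 0 ≤ s ∧ d.G s = 0 ∧ d.Ps s ∈ window k := by
  by_cases h0 : d.Ps 0 ≤ (k + 1 / 2) * π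
  · obtain ⟨s1, hs1, h1⟩ := d.exists_Ps_eq h0
    obtain ⟨s2, hs2, h2⟩ := d.exists_Ps_eq (r := ((k + 1 : ℕ) + 1 / 2) * π)
      (h0.trans (by push_cast; nlinarith [pi_pos]))
    have h12 : s1 < s2 := by
      rw [← d.Ps_strictMono.lt_iff_lt, h1, h2]; push_cast; nlinarith [pi_pos]
    have e1 := d.sign_G_of_Ps_eq hs1 h1
    have e2 := d.sign_G_of_Ps_eq hs2 h2
    rw [pow_succ] at e2
    obtain ⟨s, hs, h⟩ := intermediate_value_Ioo' h12.le
      (f := fun s => (-1) ^ k * d.G s) (d.continuous_G.const_mul _).continuousOn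
      (show (0 : ℝ) ∈ _ from ⟨by linarith, e1⟩)
    refine ⟨s, hs1.trans hs.1.le, by simpa using h, ?_, ?_⟩
    · rw [← h1]; exact d.Ps_strictMono hs.1
    · have := d.Ps_strictMono hs.2
      rw [h2] at this; push_cast at this; linarith
  -- The window begins before s = 0, which forces k = 0 and p = P = 0; then s = 0 itself is the
  -- root.
  · have hpP : d.p = 0 ∧ d.P = 0 := by
      by_contra hn
      have := d.Ps_zero_le hn
      have hk : (0 : ℝ) ≤ k := k.cast_nonneg
      nlinarith [pi_pos]
    refine ⟨0, le_rfl, d.G_zero hpP.1 hpP.2, ?_⟩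
    rw [d.Ps_zero_of_eq hpP.1 hpP.2] at h0 ⊢
    have hk0 : k = 0 := by
      by_contra hk0
      have : (1 : ℝ) ≤ k := by exact_mod_cast Nat.one_le_iff_ne_zero.2 hk0
      nlinarith [pi_pos]
    subst hk0
    constructor <;> push_cast <;> linarith [pi_pos]

/-! ### The windows contain all positive roots. -/

theorem sin_Ps_of_root {s : ℝ} (hs : 0 ≤ s) (h : d.G s = 0) : |sin (d.Ps s)| ≤
    (∑ i, |d.x i|) * cos (d.de s) + (∑ i, |d.y i|) * sin (d.de s) := by
  have := d.abs_sin_Ps_sub_G_le hs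
  rwa [h, sub_zero] at this

/-- The crude bound |sin Ψ - G| < 1 is useless for small Ψ. If Ψ ≤ π/2, however, all interior phases
lie in [0, Φ] with Φ ≤ π/2, so their sines are at most sin Φ; this sharpened estimate contradicts
the smallness of the weights. -/
theorem Ps_gt_of_root {s : ℝ} (hs : 0 < s) (h : d.G s = 0) : π / 2 < d.Ps s := by
  by_contra! hle
  have ha : 0 ≤ cos (d.de s) := cos_ang_nonneg d.hP d.hQ hs.le
  have hb : 0 ≤ sin (d.de s) := sin_ang_nonneg d.hP d.hQ hs.le
  have hab := cos_sq_add_sin_sq (d.de s)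
  have hth := d.th_nonneg hs.le
  have hde := d.de_nonneg hs.le
  have hPh0 : 0 < d.Ph s := by unfold Ph; linarith
  have hPh1 : d.Ph s ≤ π / 2 := by unfold Ps at hle; linarith
  have hS : 0 < sin (d.Ph s) := sin_pos_of_pos_of_lt_pi hPh0 (by linarith [pi_pos])
  have hc : 0 ≤ cos (d.Ph s) := cos_nonneg_of_mem_Icc ⟨by linarith, hPh1⟩
  have hX : 0 ≤ cos (d.Ps s) := cos_nonneg_of_mem_Icc ⟨by unfold Ps; linarith, hle⟩
  rw [Ps, cos_add] at hX
  have hcs := cos_sq_add_sin_sq (d.Ph s)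
  have h1 : sin (d.Ps s) ≤ (∑ i, |d.x i|) * (cos (d.de s) * sin (d.Ph s)) +
      (∑ i, |d.y i|) * sin (d.de s) := by
    rw [sub_eq_zero.1 (h : sin (d.Ps s) - _ = 0), Finset.sum_mul, Finset.sum_mul,
      ← Finset.sum_add_distrib]
    refine Finset.sum_le_sum fun i _ => ?_
    have f1 : 0 ≤ d.ph i s := add_nonneg (mul_nonneg hs.le (d.hξ0 i)) hth
    have f2 : d.ph i s ≤ d.Ph s :=
      add_le_add (mul_le_mul_of_nonneg_left (d.hξ2 i) hs.le) le_rfl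
    have f3 : 0 ≤ sin (d.ph i s) := sin_nonneg_of_nonneg_of_le_pi f1 (by linarith [pi_pos])
    have f4 : sin (d.ph i s) ≤ sin (d.Ph s) :=
      sin_le_sin_of_le_of_le_pi_div_two (by linarith) hPh1 f2
    refine add_le_add ((le_abs_self _).trans ?_) ((le_abs_self _).trans ?_)
    · rw [abs_mul, abs_mul, abs_of_nonneg ha, abs_of_nonneg f3, mul_comm (cos _), mul_assoc]
      gcongr
    · rw [abs_mul, abs_mul, abs_of_nonneg hb, mul_comm (sin _)]
      exact mul_le_of_le_one_right (by positivity) (abs_cos_le_one _)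
  rw [Ps, sin_add] at h1
  have hxy := d.hxy
  have hA := sum_abs_nonneg d.x
  have hB := sum_abs_nonneg d.y
  generalize (∑ i, |d.x i|) = A at *
  generalize (∑ i, |d.y i|) = B at *
  generalize cos (d.de s) = a at *
  generalize sin (d.de s) = b at *
  generalize sin (d.Ph s) = S at *
  generalize cos (d.Ph s) = c at *
  have ha0 : 0 < a := by
    rcases ha.eq_or_lt with h0 | h0
    · rw [← h0] at hab hX
      have hb0 : 0 < b := by nlinarith
      nlinarith [mul_pos hb0 hS]
    · exact h0
  have hS1 : S ^ 2 ≤ 1 := by nlinarith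
  have hc1 : c ≤ 1 := by nlinarith
  have e1 : 0 < a * (1 - (A * S ^ 2 + B * c)) := mul_pos ha0 (by
    nlinarith [mul_le_mul_of_nonneg_left hS1 hA, mul_le_mul_of_nonneg_left hc1 hB])
  rcases le_total B c with hBc | hBc
  · nlinarith [mul_pos ha0 hS, mul_nonneg hb (sub_nonneg.2 hBc),
      mul_pos (mul_pos ha0 hS) (show 0 < 1 - A by linarith)]
  · have e2 : S * b * (B - c) ≤ a * c * (B - c) :=
      mul_le_mul_of_nonneg_right (by linarith) (by linarith)
    have e3 : 0 < S * (a * S * (1 - A) + b * (c - B)) := by nlinarith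
    have := (mul_pos_iff_of_pos_left hS).1 e3
    nlinarith

theorem exists_window {s : ℝ} (hs : 0 < s) (h : d.G s = 0) : ∃ k, d.Ps s ∈ window k := by
  have h1 := d.Ps_gt_of_root hs h
  have h2 : 0 ≤ d.Ps s / π - 1 / 2 := by
    rw [sub_nonneg, le_div_iff₀ pi_pos]; linarith
  refine ⟨⌊d.Ps s / π - 1 / 2⌋₊, ?_⟩
  set k := ⌊d.Ps s / π - 1 / 2⌋₊ with hk
  have h3 : (k : ℝ) ≤ d.Ps s / π - 1 / 2 := Nat.floor_le h2
  have h4 : d.Ps s / π - 1 / 2 < k + 1 := Nat.lt_floor_add_one _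
  have h5 : (k + 1 / 2 : ℝ) * π ≤ d.Ps s := by rw [← le_div_iff₀ pi_pos]; linarith
  have h6 : d.Ps s < (k + 3 / 2 : ℝ) * π := by rw [← div_lt_iff₀ pi_pos]; linarith
  -- The left end of a window is excluded because `G` has a strict sign there.
  refine ⟨lt_of_le_of_ne h5 fun he => ?_, h6⟩
  have := d.sign_G_of_Ps_eq hs.le he.symm
  rw [h, mul_zero] at this
  exact lt_irrefl _ this

/-- The non-negative roots of the characteristic function, in increasing order. -/
def root (k : ℕ) : ℝ := (d.exists_root k).choose

theorem root_nonneg (k : ℕ) : 0 ≤ d.root k := (d.exists_root k).choose_spec.1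

theorem G_root (k : ℕ) : d.G (d.root k) = 0 := (d.exists_root k).choose_spec.2.1

theorem Ps_root (k : ℕ) : d.Ps (d.root k) ∈ window k := (d.exists_root k).choose_spec.2.2

theorem eq_root {k : ℕ} {s : ℝ} (hs : 0 ≤ s) (h : d.G s = 0) (hk : d.Ps s ∈ window k) :
    s = d.root k := by
  rcases lt_trichotomy s (d.root k) with hlt | heq | hgt
  · exact (d.root_unique hs hlt h (d.G_root k) hk (d.Ps_root k)).elim
  · exact heq
  · exact (d.root_unique (d.root_nonneg k) hgt (d.G_root k) h (d.Ps_root k) hk).elim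

theorem root_strictMono : StrictMono d.root := by
  refine strictMono_nat_of_lt_succ fun k => ?_
  rw [← d.Ps_strictMono.lt_iff_lt]
  have h1 := (d.Ps_root k).2
  have h2 := (d.Ps_root (k + 1)).1
  push_cast at h2
  linarith

theorem root_eq_zero_iff (k : ℕ) : d.root k = 0 ↔ k = 0 ∧ d.p = 0 ∧ d.P = 0 := by
  constructor
  · intro h
    have := d.Ps_root k
    rw [h] at this
    exact d.eq_zero_of_root_zero this
  · rintro ⟨rfl, hp, hP⟩
    refine (d.eq_root le_rfl (d.G_zero hp hP) ?_).symm
    rw [d.Ps_zero_of_eq hp hP]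
    constructor <;> push_cast <;> linarith [pi_pos]

theorem exists_root_eq {s : ℝ} (hs : 0 < s) (h : d.G s = 0) : ∃ k, d.root k = s :=
  let ⟨k, hk⟩ := d.exists_window hs h
  ⟨k, (d.eq_root hs.le h hk).symm⟩

theorem tendsto_root : Tendsto d.root atTop atTop := by
  refine tendsto_atTop_mono (f := fun k : ℕ => (k : ℝ) - 1) (fun k => ?_)
    (tendsto_atTop_add_const_right _ _ tendsto_natCast_atTop_atTop)
  have h1 := (d.Ps_root k).1
  have h2 := d.th_le (d.root k)
  have h3 := d.de_le (d.root k)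
  unfold Ps Ph at h1
  have hk : (0 : ℝ) ≤ k := k.cast_nonneg
  have h4 := mul_le_mul_of_nonneg_left two_le_pi hk
  have h5 := pi_lt_four
  nlinarith

/-! ### Position of the end phase on either side of the resonance. -/

/-- The hypothesis `Q s ≤ P` means sin δ ≤ cos δ. If Φ - kπ were at most π/2, it would be a
first-quadrant angle with cos(Ψ - kπ) ≤ 0, and `weighted_lt_of_le` would make |sin Ψ| larger than a
root permits. -/
theorem lt_Ph_of_le {k : ℕ} {s : ℝ} (hs : 0 < s) (h : d.G s = 0) (hk : d.Ps s ∈ window k)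
    (hPQ : d.Q * s ≤ d.P) : (k + 1 / 2) * π < d.Ph s := by
  by_contra! hle
  obtain ⟨ρ, hρ, e1, e2⟩ := exists_modulus d.hP d.hQ d.hPQ hs
  change d.P = ρ * cos (d.de s) at e1
  change d.Q * s = ρ * sin (d.de s) at e2
  rw [e1, e2] at hPQ
  have hba := le_of_mul_le_mul_left hPQ hρ
  have ha : 0 ≤ cos (d.de s) := cos_ang_nonneg d.hP d.hQ hs.le
  have hb : 0 ≤ sin (d.de s) := sin_ang_nonneg d.hP d.hQ hs.le
  have hde := d.de_le s
  have hPs : d.Ps s - k * π = (d.Ph s - k * π) + d.de s := by unfold Ps; ring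
  have h1 := hk.1
  have h0 := d.sin_Ps_of_root hs.le h
  have hr0 : 0 < d.Ph s - k * π := by linarith
  have hr1 : d.Ph s - k * π ≤ π / 2 := by linarith
  have hX : cos (d.Ps s - k * π) ≤ 0 :=
    cos_nonpos_of_pi_div_two_le_of_le (by linarith) (by linarith)
  have hY : |sin (d.Ps s - k * π)| = |sin (d.Ps s)| := by
    rw [sin_sub_nat_mul_pi, abs_mul, abs_neg_one_pow, one_mul]
  rw [← hY, hPs, sin_add] at h0
  rw [hPs, cos_add] at hX
  have := weighted_lt_of_le (c := cos (d.Ph s - k * π)) (s := sin (d.Ph s - k * π)) hb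
    (by nlinarith [cos_sq_add_sin_sq (d.de s)])
    (cos_nonneg_of_mem_Icc ⟨by linarith, hr1⟩)
    (sin_nonneg_of_nonneg_of_le_pi hr0.le (by linarith [pi_pos])) (cos_sq_add_sin_sq _)
    (sum_abs_nonneg d.x) (sum_abs_nonneg d.y) d.hxy hba (by linarith)
  linarith [le_abs_self (sin (d.Ph s - k * π) * cos (d.de s) +
    cos (d.Ph s - k * π) * sin (d.de s))]

/-- Mirror image of `lt_Ph_of_le`: the shift is by (k+1)π, and sine and cosine, P and Q s, and the
two families of weights exchange roles. -/
theorem Ph_lt_of_le {k : ℕ} {s : ℝ} (hs : 0 < s) (h : d.G s = 0) (hk : d.Ps s ∈ window k)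
    (hPQ : d.P ≤ d.Q * s) : d.Ph s < (k + 1) * π := by
  by_contra! hle
  obtain ⟨ρ, hρ, e1, e2⟩ := exists_modulus d.hP d.hQ d.hPQ hs
  change d.P = ρ * cos (d.de s) at e1
  change d.Q * s = ρ * sin (d.de s) at e2
  rw [e1, e2] at hPQ
  have hba := le_of_mul_le_mul_left hPQ hρ
  have ha : 0 ≤ cos (d.de s) := cos_ang_nonneg d.hP d.hQ hs.le
  have hb : 0 ≤ sin (d.de s) := sin_ang_nonneg d.hP d.hQ hs.le
  have hde := d.de_nonneg hs.le
  have hPs : d.Ps s - (k + 1 : ℕ) * π = (d.Ph s - (k + 1 : ℕ) * π) + d.de s := by unfold Ps; ring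
  have h1 := hk.2
  have h0 := d.sin_Ps_of_root hs.le h
  have hr0 : 0 ≤ d.Ph s - (k + 1 : ℕ) * π := by push_cast; linarith
  have hX0 : d.Ps s - (k + 1 : ℕ) * π ≤ π / 2 := by push_cast; linarith
  have hX : 0 ≤ cos (d.Ps s - (k + 1 : ℕ) * π) :=
    cos_nonneg_of_mem_Icc ⟨by linarith [pi_pos], hX0⟩
  have hY : |sin (d.Ps s - (k + 1 : ℕ) * π)| = |sin (d.Ps s)| := by
    rw [sin_sub_nat_mul_pi, abs_mul, abs_neg_one_pow, one_mul]
  rw [← hY, hPs, sin_add] at h0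
  rw [hPs, cos_add] at hX
  have hcs := cos_sq_add_sin_sq (d.Ph s - (k + 1 : ℕ) * π)
  have := weighted_lt_of_le (s := cos (d.Ph s - (k + 1 : ℕ) * π))
    (c := sin (d.Ph s - (k + 1 : ℕ) * π)) ha
    (by nlinarith [cos_sq_add_sin_sq (d.de s)])
    (sin_nonneg_of_nonneg_of_le_pi hr0 (by linarith [pi_pos]))
    (cos_nonneg_of_mem_Icc ⟨by linarith [pi_pos], by linarith⟩) (by linarith)
    (sum_abs_nonneg d.y) (sum_abs_nonneg d.x) (by linarith [d.hxy]) hba (by linarith)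
  linarith [le_abs_self (sin (d.Ph s - (k + 1 : ℕ) * π) * cos (d.de s) +
    cos (d.Ph s - (k + 1 : ℕ) * π) * sin (d.de s))]

end CharData

/-! ### Calculus on `[-1,1]` -/

theorem uniqueDiffOn_I : UniqueDiffOn ℝ I := uniqueDiffOn_Icc (by norm_num)

theorem neg_one_mem_I : (-1 : ℝ) ∈ I := ⟨le_rfl, by norm_num⟩

theorem one_mem_I : (1 : ℝ) ∈ I := ⟨by norm_num, le_rfl⟩

theorem D_eq_of_hasDerivAt {f : ℝ → ℝ} {f' x : ℝ} (hx : x ∈ I) (h : HasDerivAt f f' x) :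
    D f x = f' := h.hasDerivWithinAt.derivWithin (uniqueDiffOn_I x hx)

theorem D_congr {f g : ℝ → ℝ} (h : ∀ x ∈ I, f x = g x) {x : ℝ} (hx : x ∈ I) : D f x = D g x :=
  derivWithin_congr h (h x hx)

theorem IsC2.contDiffOn_D {u : ℝ → ℝ} (hu : IsC2 u) : ContDiffOn ℝ 1 (D u) I :=
  ContDiffOn.derivWithin hu uniqueDiffOn_I (by norm_num)

theorem IsC2.hasDerivAt {u : ℝ → ℝ} (hu : IsC2 u) {x : ℝ} (hx : x ∈ Ioo (-1 : ℝ) 1) :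
    HasDerivAt u (D u x) x :=
  ((hu.differentiableOn (by norm_num)) x (Ioo_subset_Icc_self hx)).hasDerivWithinAt.hasDerivAt
    (Icc_mem_nhds hx.1 hx.2)

theorem IsC2.hasDerivAt_D {u : ℝ → ℝ} (hu : IsC2 u) {x : ℝ} (hx : x ∈ Ioo (-1 : ℝ) 1) :
    HasDerivAt (D u) (D (D u) x) x :=
  ((hu.contDiffOn_D.differentiableOn (by norm_num)) x
    (Ioo_subset_Icc_self hx)).hasDerivWithinAt.hasDerivAt (Icc_mem_nhds hx.1 hx.2)

theorem eq_left_of_deriv_eq_zero {f : ℝ → ℝ} (hf : ContinuousOn f I)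
    (h : ∀ x ∈ Ioo (-1 : ℝ) 1, HasDerivAt f 0 x) {x : ℝ} (hx : x ∈ I) : f x = f (-1) := by
  rcases hx.1.eq_or_lt with rfl | hlt
  · rfl
  · obtain ⟨y, hy, h0⟩ := exists_hasDerivAt_eq_slope f (fun _ => 0) hlt
      (hf.mono (Icc_subset_Icc_right hx.2)) fun y hy => h y ⟨hy.1, hy.2.trans_le hx.2⟩
    rw [eq_comm, div_eq_zero_iff] at h0
    rcases h0 with h0 | h0 <;> linarith

/-- Solutions of `-u'' = lam u` are combinations of a fundamental system `c, e`. -/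
theorem solution_eq {u c c' e e' : ℝ → ℝ} {lam : ℝ} (hu : IsC2 u)
    (heq : ∀ x ∈ Ioo (-1 : ℝ) 1, -(D (D u) x) = lam * u x)
    (hc : ∀ x, HasDerivAt c (c' x) x) (hc' : ∀ x, HasDerivAt c' (-lam * c x) x)
    (he : ∀ x, HasDerivAt e (e' x) x) (he' : ∀ x, HasDerivAt e' (-lam * e x) x)
    (c0 : c (-1) = 1) (c0' : c' (-1) = 0) (e0 : e (-1) = 0) (e0' : e' (-1) = 1)
    {x : ℝ} (hx : x ∈ I) : u x = u (-1) * c x + D u (-1) * e x ∧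
      D u x = u (-1) * c' x + D u (-1) * e' x := by
  have cc : Continuous c := continuous_iff_continuousAt.2 fun x => (hc x).continuousAt
  have cc' : Continuous c' := continuous_iff_continuousAt.2 fun x => (hc' x).continuousAt
  have ce : Continuous e := continuous_iff_continuousAt.2 fun x => (he x).continuousAt
  have ce' : Continuous e' := continuous_iff_continuousAt.2 fun x => (he' x).continuousAt
  have cu : ContinuousOn u I := hu.continuousOn
  have cu' : ContinuousOn (D u) I := hu.contDiffOn_D.continuousOn
  -- The three Wronskians of u, c and e are constant; Cramer's rule then recovers u and its
  -- derivative.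
  have w : c x * e' x - c' x * e x = c (-1) * e' (-1) - c' (-1) * e (-1) :=
    eq_left_of_deriv_eq_zero (f := fun x => c x * e' x - c' x * e x) (by fun_prop)
      (fun y _ => (((hc y).mul (he' y)).sub ((hc' y).mul (he y))).congr_deriv (by ring)) hx
  have w1 : u x * c' x - D u x * c x = u (-1) * c' (-1) - D u (-1) * c (-1) :=
    eq_left_of_deriv_eq_zero (f := fun x => u x * c' x - D u x * c x) (by fun_prop)
      (fun y hy => (((hu.hasDerivAt hy).mul (hc' y)).sub
        ((hu.hasDerivAt_D hy).mul (hc y))).congr_deriv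
          (by linear_combination c y * heq y hy)) hx
  have w2 : u x * e' x - D u x * e x = u (-1) * e' (-1) - D u (-1) * e (-1) :=
    eq_left_of_deriv_eq_zero (f := fun x => u x * e' x - D u x * e x) (by fun_prop)
      (fun y hy => (((hu.hasDerivAt hy).mul (he' y)).sub
        ((hu.hasDerivAt_D hy).mul (he y))).congr_deriv
          (by linear_combination e y * heq y hy)) hx
  rw [c0, c0', e0, e0'] at *
  constructor
  · linear_combination (-u x) * w + c x * w2 - e x * w1
  · linear_combination (-D u x) * w + c' x * w2 - e' x * w1

theorem kth_range {f : ℕ → ℝ} (hf : StrictMono f) (k : ℕ) : kth (range f) k = f k := by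
  induction k with
  | zero =>
    refine IsLeast.csInf_eq ⟨mem_range_self _, ?_⟩
    rintro _ ⟨j, rfl⟩
    exact hf.monotone (Nat.zero_le j)
  | succ k ih =>
    rw [kth, ih]
    refine IsLeast.csInf_eq ⟨⟨mem_range_self _, hf k.lt_succ_self⟩, ?_⟩
    rintro _ ⟨⟨j, rfl⟩, hj⟩
    exact hf.monotone (hf.lt_iff_lt.1 hj)

/-! ### The characteristic function of a boundary value problem -/

theorem BC.StrongBound.a_eq {r : BC} (h : r.StrongBound) (i : Fin r.m) :
    r.a i = r.a₀ * (r.a i / r.a₀) := by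
  by_cases h0 : r.a₀ = 0
  · have := (Finset.sum_eq_zero_iff_of_nonneg fun i _ => abs_nonneg (r.a i)).1 (h.1 h0) i
      (Finset.mem_univ i)
    rw [abs_eq_zero.1 this]; simp
  · rw [mul_div_cancel₀ _ h0]

theorem BC.StrongBound.b_eq {r : BC} (h : r.StrongBound) (i : Fin r.m) :
    r.b i = r.b₀ * (r.b i / r.b₀) := by
  by_cases h0 : r.b₀ = 0
  · have := (Finset.sum_eq_zero_iff_of_nonneg fun i _ => abs_nonneg (r.b i)).1 (h.2.1 h0) i
      (Finset.mem_univ i)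
    rw [abs_eq_zero.1 this]; simp
  · rw [mul_div_cancel₀ _ h0]

theorem BC.Admissible.b₀_nonneg {r : BC} (hr : r.Admissible 1) : 0 ≤ r.b₀ := by
  simpa using hr.sign

/-- The characteristic data of the problem with left condition `l` (taken to be a single-point
condition) and right condition `r`. -/
def charData {l r : BC} (hl : l.Admissible (-1)) (hr : r.Admissible 1) (hrs : r.StrongBound) :
    CharData r.m where
  p := l.a₀
  q := -l.b₀
  P := r.a₀
  Q := r.b₀
  x i := r.a i / r.a₀
  y i := r.b i / r.b₀
  ξ i := r.η i + 1
  hp := hl.nonneg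
  hq := by linarith [hl.sign]
  hpq := by
    have := hl.nondegenerate
    rwa [abs_of_nonpos (by linarith [hl.sign])] at this
  hP := hr.nonneg
  hQ := hr.b₀_nonneg
  hPQ := by
    have := hr.nondegenerate
    rwa [abs_of_nonneg hr.b₀_nonneg] at this
  hξ0 i := by linarith [(hr.mem i).1]
  hξ2 i := by linarith [(hr.mem i).2]
  hxy := by
    have := hrs.2.2
    rw [Finset.sum_div, Finset.sum_div] at this
    simpa only [abs_div, abs_of_nonneg hr.nonneg, abs_of_nonneg hr.b₀_nonneg] using this

/-- The standard solution of `-u'' = s² u` satisfying the left boundary condition. -/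
def CharData.sol {m : ℕ} (d : CharData m) (s x : ℝ) : ℝ := sin (s * (x + 1) + d.th s)

/-- The derivative of the standard solution, divided by `s`. -/
def CharData.cosol {m : ℕ} (d : CharData m) (s x : ℝ) : ℝ := cos (s * (x + 1) + d.th s)

theorem CharData.hasDerivAt_sol {m : ℕ} (d : CharData m) (s x : ℝ) :
    HasDerivAt (d.sol s) (s * d.cosol s x) x := by
  have h : HasDerivAt (fun x => s * (x + 1) + d.th s) s x := by
    simpa using (((hasDerivAt_id x).add_const 1).const_mul s).add_const (d.th s)
  exact h.sin.congr_deriv (mul_comm _ _)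

theorem CharData.hasDerivAt_cosol {m : ℕ} (d : CharData m) (s x : ℝ) :
    HasDerivAt (d.cosol s) (-(s * d.sol s x)) x := by
  have h : HasDerivAt (fun x => s * (x + 1) + d.th s) s x := by
    simpa using (((hasDerivAt_id x).add_const 1).const_mul s).add_const (d.th s)
  exact h.cos.congr_deriv (by rw [CharData.sol]; ring)


/-- The scalar R cancels, and U, V live on [0, 2], the interval translated by 1. Factoring `a i` and
`b i` through `a₀` and `b₀` is legitimate even for a zero denominator, as the numerators then
vanish. -/
theorem holdsAt_right_iff {l r : BC} (hl : l.Admissible (-1)) (hr : r.Admissible 1)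
    (hrs : r.StrongBound)
    {u U V : ℝ → ℝ} {R : ℝ} (hR : R ≠ 0)
    (hu : ∀ x ∈ I, u x = R * U (x + 1)) (hu' : ∀ x ∈ I, D u x = R * V (x + 1)) :
    r.HoldsAt 1 u ↔ (charData hl hr hrs).P * U 2 + (charData hl hr hrs).Q * V 2 =
      ∑ i, (charData hl hr hrs).P * ((charData hl hr hrs).x i * U ((charData hl hr hrs).ξ i)) +
      ∑ i, (charData hl hr hrs).Q * ((charData hl hr hrs).y i * V ((charData hl hr hrs).ξ i)) := by
  have e1 : ∑ i, r.a i * u (r.η i) = R * ∑ i, (charData hl hr hrs).P *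
      ((charData hl hr hrs).x i * U ((charData hl hr hrs).ξ i)) := by
    rw [Finset.mul_sum]
    refine Finset.sum_congr rfl fun i _ => ?_
    rw [hu _ (hr.mem i), hrs.a_eq i]
    simp only [charData]; ring
  have e2 : ∑ i, r.b i * D u (r.η i) = R * ∑ i, (charData hl hr hrs).Q *
      ((charData hl hr hrs).y i * V ((charData hl hr hrs).ξ i)) := by
    rw [Finset.mul_sum]
    refine Finset.sum_congr rfl fun i _ => ?_
    rw [hu' _ (hr.mem i), hrs.b_eq i]
    simp only [charData]; ring
  have e3 : r.a₀ * u 1 + r.b₀ * D u 1 = R * ((charData hl hr hrs).P * U 2 +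
      (charData hl hr hrs).Q * V 2) := by
    rw [hu _ one_mem_I, hu' _ one_mem_I, one_add_one_eq_two]
    simp only [charData]; ring
  rw [BC.HoldsAt, e1, e2, e3, ← mul_add]
  exact mul_right_inj' hR

theorem CharData.trig_iff {m : ℕ} (d : CharData m) {s : ℝ} (hs : 0 < s) :
    d.P * sin (s * 2 + d.th s) + d.Q * (s * cos (s * 2 + d.th s)) =
      ∑ i, d.P * (d.x i * sin (s * d.ξ i + d.th s)) +
      ∑ i, d.Q * (d.y i * (s * cos (s * d.ξ i + d.th s))) ↔ d.G s = 0 := by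
  obtain ⟨ρ, hρ, e1, e2⟩ := exists_modulus d.hP d.hQ d.hPQ hs
  change d.P = ρ * cos (d.de s) at e1
  change d.Q * s = ρ * sin (d.de s) at e2
  have h1 : d.P * sin (s * 2 + d.th s) + d.Q * (s * cos (s * 2 + d.th s)) =
      ρ * sin (d.Ps s) := by
    rw [← mul_assoc, e1, e2, Ps, Ph, sin_add _ (d.de s)]; ring
  have h2 : ∑ i, d.P * (d.x i * sin (s * d.ξ i + d.th s)) +
      ∑ i, d.Q * (d.y i * (s * cos (s * d.ξ i + d.th s))) =
      ρ * ∑ i, (cos (d.de s) * d.x i * sin (d.ph i s) +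
        sin (d.de s) * d.y i * cos (d.ph i s)) := by
    rw [← Finset.sum_add_distrib, Finset.mul_sum]
    refine Finset.sum_congr rfl fun i _ => ?_
    rw [ph]
    linear_combination (d.x i * sin (s * d.ξ i + d.th s)) * e1 +
      (d.y i * cos (s * d.ξ i + d.th s)) * e2
  rw [h1, h2, mul_right_inj' hρ.ne', G, sub_eq_zero]

/-- Each interior value is at most the end value, so P U(2) + Q V(2) ≤ A P U(2) + B Q V(2) with A, B
< 1 and nonnegative terms. This disposes of `lam < 0` and determines the case `lam = 0`. -/
theorem CharData.monotone_pair {m : ℕ} (d : CharData m) {U V : ℝ → ℝ}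
    (hU0 : 0 ≤ U 0) (hV0 : 0 ≤ V 0) (hU : MonotoneOn U (Ici 0)) (hV : MonotoneOn V (Ici 0))
    (h : d.P * U 2 + d.Q * V 2 =
      ∑ i, d.P * (d.x i * U (d.ξ i)) + ∑ i, d.Q * (d.y i * V (d.ξ i))) :
    d.P * U 2 = 0 ∧ d.Q * V 2 = 0 := by
  have key : ∀ (W : ℝ → ℝ), 0 ≤ W 0 → MonotoneOn W (Ici 0) → ∀ (z : Fin m → ℝ) (c : ℝ), 0 ≤ c →
      ∑ i, c * (z i * W (d.ξ i)) ≤ (∑ i, |z i|) * (c * W 2) := by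
    intro W hW0 hW z c hc
    rw [Finset.sum_mul]
    refine Finset.sum_le_sum fun i _ => ?_
    have e1 : 0 ≤ W (d.ξ i) := hW0.trans (hW (by simp) (d.hξ0 i) (d.hξ0 i))
    have e2 : W (d.ξ i) ≤ W 2 := hW (d.hξ0 i) (by simp) (d.hξ2 i)
    rw [mul_left_comm]
    exact (mul_le_mul_of_nonneg_right (le_abs_self (z i)) (by positivity)).trans (by gcongr)
  have h1 := key U hU0 hU d.x d.P d.hP
  have h2 := key V hV0 hV d.y d.Q d.hQ
  have hU2 : 0 ≤ d.P * U 2 := mul_nonneg d.hP (hU0.trans (hU (by simp) (by simp) (by simp)))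
  have hV2 : 0 ≤ d.Q * V 2 := mul_nonneg d.hQ (hV0.trans (hV (by simp) (by simp) (by simp)))
  have hA := sum_abs_nonneg d.x
  have hB := sum_abs_nonneg d.y
  have hxy := d.hxy
  generalize (∑ i, |d.x i|) = A at *
  generalize (∑ i, |d.y i|) = B at *
  have h3 : 0 ≤ (1 - A) * (d.P * U 2) := mul_nonneg (by linarith) hU2
  have h4 : 0 ≤ (1 - B) * (d.Q * V 2) := mul_nonneg (by linarith) hV2
  exact ⟨(mul_eq_zero.1 (show (1 - A) * (d.P * U 2) = 0 by linarith)).resolve_left (by linarith),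
    (mul_eq_zero.1 (show (1 - B) * (d.Q * V 2) = 0 by linarith)).resolve_left (by linarith)⟩

theorem holdsAt_left_iff {l r : BC} (hl : l.Admissible (-1)) (hr : r.Admissible 1)
    (hrs : r.StrongBound)
    (hla : ∀ i, l.a i = 0) (hlb : ∀ i, l.b i = 0) (u : ℝ → ℝ) :
    l.HoldsAt (-1) u ↔
      (charData hl hr hrs).p * u (-1) = (charData hl hr hrs).q * D u (-1) := by
  simp only [BC.HoldsAt, hla, hlb, zero_mul, Finset.sum_const_zero, add_zero, charData]
  constructor <;> intro h <;> linarith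

/-- An eigenfunction is a multiple of the solution with initial data `(q, p)`. -/
theorem eigenfunction_eq {l r : BC} (hl : l.Admissible (-1)) (hr : r.Admissible 1)
    (hrs : r.StrongBound)
    (hla : ∀ i, l.a i = 0) (hlb : ∀ i, l.b i = 0) {lam : ℝ} {u : ℝ → ℝ}
    (h : IsEigenfunction l r lam u) {c c' e e' : ℝ → ℝ}
    (hc : ∀ x, HasDerivAt c (c' x) x) (hc' : ∀ x, HasDerivAt c' (-lam * c x) x)
    (he : ∀ x, HasDerivAt e (e' x) x) (he' : ∀ x, HasDerivAt e' (-lam * e x) x)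
    (c0 : c 0 = 1) (c0' : c' 0 = 0) (e0 : e 0 = 0) (e0' : e' 0 = 1) :
    ∃ R, R ≠ 0 ∧
      (∀ x ∈ I, u x = R * ((charData hl hr hrs).q * c (x + 1) +
        (charData hl hr hrs).p * e (x + 1))) ∧
      (∀ x ∈ I, D u x = R * ((charData hl hr hrs).q * c' (x + 1) +
        (charData hl hr hrs).p * e' (x + 1))) := by
  set d := charData hl hr hrs
  have hleft : d.p * u (-1) = d.q * D u (-1) := (holdsAt_left_iff hl hr hrs hla hlb u).1 h.left
  have hN : 0 < d.p ^ 2 + d.q ^ 2 := by nlinarith [pow_pos d.hpq 2, sq_nonneg (d.p - d.q)]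
  have sol := fun (x : ℝ) (hx : x ∈ I) => solution_eq (c := fun x => c (x + 1))
    (c' := fun x => c' (x + 1)) (e := fun x => e (x + 1)) (e' := fun x => e' (x + 1)) h.c2 h.eqn
    (fun x => (hc (x + 1)).comp_add_const x 1) (fun x => (hc' (x + 1)).comp_add_const x 1)
    (fun x => (he (x + 1)).comp_add_const x 1) (fun x => (he' (x + 1)).comp_add_const x 1)
    (by simpa using c0) (by simpa using c0') (by simpa using e0) (by simpa using e0') hx
  have h1 : u (-1) = (d.q * u (-1) + d.p * D u (-1)) / (d.p ^ 2 + d.q ^ 2) * d.q := by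
    field_simp; linear_combination d.p * hleft
  have h2 : D u (-1) = (d.q * u (-1) + d.p * D u (-1)) / (d.p ^ 2 + d.q ^ 2) * d.p := by
    field_simp; linear_combination (-d.q) * hleft
  -- The initial data are parallel to (q, p); R is the coefficient of their projection onto that
  -- vector.
  set R := (d.q * u (-1) + d.p * D u (-1)) / (d.p ^ 2 + d.q ^ 2)
  refine ⟨R, fun hR => ?_, fun x hx => ?_, fun x hx => ?_⟩
  · obtain ⟨x, hx, hux⟩ := h.nontrivial
    rw [hR, zero_mul] at h1 h2
    exact hux (by rw [(sol x hx).1, h1, h2]; ring)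
  · rw [(sol x hx).1]; linear_combination c (x + 1) * h1 + e (x + 1) * h2
  · rw [(sol x hx).2]; linear_combination c' (x + 1) * h1 + e' (x + 1) * h2

/-- With the hyperbolic fundamental system, both the solution and its derivative are positive at the
right end, so `monotone_pair` would force P = Q = 0. -/
theorem eigenvalue_nonneg {l r : BC} (hl : l.Admissible (-1)) (hr : r.Admissible 1)
    (hrs : r.StrongBound)
    (hla : ∀ i, l.a i = 0) (hlb : ∀ i, l.b i = 0) {lam : ℝ} {u : ℝ → ℝ}
    (h : IsEigenfunction l r lam u) : 0 ≤ lam := by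
  by_contra! hneg
  set s := √(-lam) with hs
  have hs0 : 0 < s := sqrt_pos.2 (by linarith)
  have hs2 : s ^ 2 = -lam := sq_sqrt (by linarith)
  have hlin : ∀ x : ℝ, HasDerivAt (fun x => s * x) s x := fun x => by
    simpa using (hasDerivAt_id x).const_mul s
  obtain ⟨R, hR, hu, hu'⟩ := eigenfunction_eq hl hr hrs hla hlb h
    (c := fun x => cosh (s * x)) (c' := fun x => s * sinh (s * x))
    (e := fun x => sinh (s * x) / s) (e' := fun x => cosh (s * x))
    (fun x => (hlin x).cosh.congr_deriv (mul_comm _ _))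
    (fun x => ((hlin x).sinh.const_mul s).congr_deriv (by rw [← hs2]; ring))
    (fun x => ((hlin x).sinh.div_const s).congr_deriv (by field_simp))
    (fun x => (hlin x).cosh.congr_deriv (by rw [← hs2]; field_simp))
    (by simp) (by simp) (by simp) (by simp)
  set d := charData hl hr hrs
  have hmc : MonotoneOn (fun x => cosh (s * x)) (Ici 0) := fun x hx y hy hxy => by
    refine cosh_le_cosh.2 ?_
    rw [abs_of_nonneg (mul_nonneg hs0.le hx), abs_of_nonneg (mul_nonneg hs0.le hy)]
    exact mul_le_mul_of_nonneg_left hxy hs0.le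
  have hms : MonotoneOn (fun x => sinh (s * x)) (Ici 0) := fun x _ y _ hxy =>
    sinh_le_sinh.2 (mul_le_mul_of_nonneg_left hxy hs0.le)
  have hp := d.hp
  have hq := d.hq
  have hpq := d.hpq
  have hsh : 0 < sinh (s * 2) := sinh_pos_iff.2 (by positivity)
  have hch := cosh_pos (s * 2)
  have key := d.monotone_pair (U := fun x => d.q * cosh (s * x) + d.p * (sinh (s * x) / s))
    (V := fun x => d.q * (s * sinh (s * x)) + d.p * cosh (s * x)) (by simpa using hq)
    (by simpa using hp)
    (fun x hx y hy hxy => by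
      have := hmc hx hy hxy
      have := hms hx hy hxy
      dsimp only at *
      gcongr)
    (fun x hx y hy hxy => by
      have := hmc hx hy hxy
      have := hms hx hy hxy
      dsimp only at *
      gcongr)
    ((holdsAt_right_iff hl hr hrs (U := fun x => d.q * cosh (s * x) + d.p * (sinh (s * x) / s))
      (V := fun x => d.q * (s * sinh (s * x)) + d.p * cosh (s * x)) hR hu hu').1 h.right)
  have hU2 : 0 < d.q * cosh (s * 2) + d.p * (sinh (s * 2) / s) := by
    rcases hq.eq_or_lt with h0 | h0
    · rw [← h0, add_zero] at hpq; positivity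
    · positivity
  have hV2 : 0 < d.q * (s * sinh (s * 2)) + d.p * cosh (s * 2) := by
    rcases hq.eq_or_lt with h0 | h0
    · rw [← h0, add_zero] at hpq; positivity
    · positivity
  have h1 := (mul_eq_zero.1 key.1).resolve_right hU2.ne'
  have h2 := (mul_eq_zero.1 key.2).resolve_right hV2.ne'
  linarith [d.hPQ]

/-- The shape of the eigenfunctions. -/
theorem eigenfunction_shape {l r : BC} (hl : l.Admissible (-1)) (hr : r.Admissible 1)
    (hrs : r.StrongBound)
    (hla : ∀ i, l.a i = 0) (hlb : ∀ i, l.b i = 0) {lam : ℝ} {u : ℝ → ℝ}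
    (h : IsEigenfunction l r lam u) :
    ∃ k, (charData hl hr hrs).root k ^ 2 = lam ∧ ∃ R, R ≠ 0 ∧
      (∀ x ∈ I, u x = R * (charData hl hr hrs).sol ((charData hl hr hrs).root k) x) ∧
      (∀ x ∈ I, D u x = R * ((charData hl hr hrs).root k *
        (charData hl hr hrs).cosol ((charData hl hr hrs).root k) x)) := by
  rcases (eigenvalue_nonneg hl hr hrs hla hlb h).eq_or_lt with h0 | hpos
  · obtain ⟨R, hR, hu, hu'⟩ := eigenfunction_eq hl hr hrs hla hlb h
      (c := fun _ => 1) (c' := fun _ => 0) (e := fun x => x) (e' := fun _ => 1)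
      (fun x => hasDerivAt_const _ _)
      (fun x => (hasDerivAt_const _ _).congr_deriv (by rw [← h0]; ring))
      (fun x => hasDerivAt_id _)
      (fun x => (hasDerivAt_const _ _).congr_deriv (by rw [← h0]; ring)) rfl rfl rfl rfl
    set d := charData hl hr hrs
    have hp := d.hp
    have hq := d.hq
    have hpq := d.hpq
    have key := d.monotone_pair (U := fun x => d.q * 1 + d.p * x)
      (V := fun _ => d.q * 0 + d.p * 1) (by simpa using hq) (by simpa using hp)
      (fun x _ y _ hxy => by dsimp only; gcongr) (fun x _ y _ _ => le_rfl)
      ((holdsAt_right_iff hl hr hrs (U := fun x => d.q * 1 + d.p * x)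
        (V := fun _ => d.q * 0 + d.p * 1) hR hu hu').1 h.right)
    -- The affine solution q + p x is positive at x = 2, hence P = 0; then Q > 0 makes the slope p
    -- vanish, so only the constant solution survives and the root is number 0.
    have hP : d.P = 0 := (mul_eq_zero.1 key.1).resolve_right (by linarith)
    have hp0 : d.p = 0 := by
      have hQ := d.hPQ
      have := (mul_eq_zero.1 key.2).resolve_left (by linarith)
      linarith
    have hr0 := (d.root_eq_zero_iff 0).2 ⟨rfl, hp0, hP⟩
    have hq0 : d.q ≠ 0 := by linarith
    refine ⟨0, by rw [hr0, ← h0]; norm_num, R * d.q, mul_ne_zero hR hq0, fun x hx => ?_,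
      fun x hx => ?_⟩
    · rw [hu x hx, hr0, hp0, CharData.sol, CharData.th, hp0, ang_zero_left]; simp
    · rw [hu' x hx, hr0, hp0]; simp
  · set s := √lam with hs
    have hs0 : 0 < s := sqrt_pos.2 hpos
    have hs2 : s ^ 2 = lam := sq_sqrt hpos.le
    have hlin : ∀ x : ℝ, HasDerivAt (fun x => s * x) s x := fun x => by
      simpa using (hasDerivAt_id x).const_mul s
    obtain ⟨R, hR, hu, hu'⟩ := eigenfunction_eq hl hr hrs hla hlb h
      (c := fun x => cos (s * x)) (c' := fun x => -s * sin (s * x))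
      (e := fun x => sin (s * x) / s) (e' := fun x => cos (s * x))
      (fun x => (hlin x).cos.congr_deriv (by ring))
      (fun x => ((hlin x).sin.const_mul (-s)).congr_deriv (by rw [← hs2]; ring))
      (fun x => ((hlin x).sin.div_const s).congr_deriv (by field_simp))
      (fun x => (hlin x).cos.congr_deriv (by rw [← hs2]; field_simp))
      (by simp) (by simp) (by simp) (by simp)
    set d := charData hl hr hrs with hd
    obtain ⟨ρ, hρ, e1, e2⟩ := exists_modulus d.hp d.hq d.hpq hs0
    change d.p = ρ * cos (d.th s) at e1
    change d.q * s = ρ * sin (d.th s) at e2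
    have hR' : R * ρ / s ≠ 0 := div_ne_zero (mul_ne_zero hR hρ.ne') hs0.ne'
    have f1 : ∀ x ∈ I, u x = R * ρ / s * sin (s * (x + 1) + d.th s) := fun x hx => by
      rw [hu x hx, sin_add]
      field_simp
      linear_combination sin (s * (x + 1)) * e1 + cos (s * (x + 1)) * e2
    have f2 : ∀ x ∈ I, D u x = R * ρ / s * (s * cos (s * (x + 1) + d.th s)) := fun x hx => by
      rw [hu' x hx, cos_add]
      field_simp
      linear_combination cos (s * (x + 1)) * e1 - sin (s * (x + 1)) * e2
    have hG : d.G s = 0 := (d.trig_iff hs0).1 ((holdsAt_right_iff hl hr hrs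
      (U := fun y => sin (s * y + d.th s)) (V := fun y => s * cos (s * y + d.th s))
      hR' f1 f2).1 h.right)
    obtain ⟨k, hk⟩ := d.exists_root_eq hs0 hG
    exact ⟨k, by rw [hk, hs2], _, hR', by rw [hk]; exact f1, by rw [hk]; exact f2⟩

theorem isEigenfunction_sol {l r : BC} (hl : l.Admissible (-1)) (hr : r.Admissible 1)
    (hrs : r.StrongBound)
    (hla : ∀ i, l.a i = 0) (hlb : ∀ i, l.b i = 0) (k : ℕ) :
    IsEigenfunction l r ((charData hl hr hrs).root k ^ 2)
      ((charData hl hr hrs).sol ((charData hl hr hrs).root k)) := by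
  set d := charData hl hr hrs with hd
  set s := d.root k with hs
  have hD : ∀ x ∈ I, D (d.sol s) x = s * d.cosol s x := fun x hx =>
    D_eq_of_hasDerivAt hx (d.hasDerivAt_sol s x)
  have h0 : d.p * sin (d.th s) = d.q * s * cos (d.th s) := mul_sin_ang _ _ _
  refine ⟨?_, fun x hx => ?_, ?_, ?_, ?_⟩
  · unfold CharData.sol
    exact ContDiff.contDiffOn (by fun_prop)
  · have hx' : x ∈ I := Ioo_subset_Icc_self hx
    rw [D_congr hD hx', D_eq_of_hasDerivAt hx' ((d.hasDerivAt_cosol s x).const_mul s)]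
    ring
  · rw [holdsAt_left_iff hl hr hrs hla hlb, hD _ neg_one_mem_I, ← hd]
    simp only [CharData.sol, CharData.cosol, neg_add_cancel, mul_zero, zero_add]
    rw [h0]; ring
  · refine (holdsAt_right_iff hl hr hrs (U := fun y => sin (s * y + d.th s))
      (V := fun y => s * cos (s * y + d.th s)) one_ne_zero
      (fun x _ => (one_mul _).symm) (fun x hx => (hD x hx).trans (one_mul _).symm)).2 ?_
    rcases (d.root_nonneg k).eq_or_lt with h1 | h1
    · obtain ⟨_, _, hP⟩ := (d.root_eq_zero_iff k).1 h1.symm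
      rw [← hs] at h1
      rw [← hd, hP, ← h1]; simp
    · exact (d.trig_iff h1).2 (d.G_root k)
  · by_contra! hn
    have h1 : D (d.sol s) (-1) = 0 := by
      rw [D_congr (g := fun _ => 0) hn neg_one_mem_I]
      exact D_eq_of_hasDerivAt neg_one_mem_I (hasDerivAt_const _ _)
    have h2 := hn _ neg_one_mem_I
    rw [hD _ neg_one_mem_I] at h1
    simp only [CharData.sol, CharData.cosol, neg_add_cancel, mul_zero, zero_add] at h1 h2
    have h3 := sin_sq_add_cos_sq (d.th s)
    rcases mul_eq_zero.1 h1 with h4 | h4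
    · rw [hs] at h4
      obtain ⟨_, hp, _⟩ := (d.root_eq_zero_iff k).1 h4
      rw [CharData.th, hp, ang_zero_left] at h2
      norm_num at h2
    · rw [h2, h4] at h3; norm_num at h3

theorem spec_eq {l r : BC} (hl : l.Admissible (-1)) (hr : r.Admissible 1)
    (hrs : r.StrongBound)
    (hla : ∀ i, l.a i = 0) (hlb : ∀ i, l.b i = 0) :
    spec l r = range fun k => (charData hl hr hrs).root k ^ 2 := by
  ext lam
  constructor
  · rintro ⟨u, hu⟩
    obtain ⟨k, hk, -⟩ := eigenfunction_shape hl hr hrs hla hlb hu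
    exact ⟨k, hk⟩
  · rintro ⟨k, rfl⟩
    exact ⟨_, isEigenfunction_sol hl hr hrs hla hlb k⟩

theorem strictMono_root_sq {l r : BC} (hl : l.Admissible (-1)) (hr : r.Admissible 1)
    (hrs : r.StrongBound) :
    StrictMono fun k => (charData hl hr hrs).root k ^ 2 :=
  fun _ _ h => pow_lt_pow_left₀ ((charData hl hr hrs).root_strictMono h)
    ((charData hl hr hrs).root_nonneg _) two_ne_zero

theorem eig_eq {l r : BC} (hl : l.Admissible (-1)) (hr : r.Admissible 1)
    (hrs : r.StrongBound)
    (hla : ∀ i, l.a i = 0) (hlb : ∀ i, l.b i = 0) (k : ℕ) :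
    eig l r k = (charData hl hr hrs).root k ^ 2 := by
  rw [eig, spec_eq hl hr hrs hla hlb]
  exact kth_range (strictMono_root_sq hl hr hrs) k

theorem spectrumListed {l r : BC} (hl : l.Admissible (-1)) (hr : r.Admissible 1)
    (hrs : r.StrongBound)
    (hla : ∀ i, l.a i = 0) (hlb : ∀ i, l.b i = 0) : SpectrumListed l r := by
  have h : eig l r = fun k => (charData hl hr hrs).root k ^ 2 :=
    funext (eig_eq hl hr hrs hla hlb)
  refine ⟨?_, ?_, ?_⟩
  · rw [h]; exact strictMono_root_sq hl hr hrs
  · rw [h, spec_eq hl hr hrs hla hlb]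
  · rw [h]
    exact (tendsto_pow_atTop two_ne_zero).comp (charData hl hr hrs).tendsto_root

/-- The eigenfunctions of the eigenvalue number `k`. -/
theorem eigenfunction_eig_shape {l r : BC} (hl : l.Admissible (-1)) (hr : r.Admissible 1)
    (hrs : r.StrongBound)
    (hla : ∀ i, l.a i = 0) (hlb : ∀ i, l.b i = 0) {k : ℕ}
    {u : ℝ → ℝ} (h : IsEigenfunction l r (eig l r k) u) : ∃ R, R ≠ 0 ∧
      ∀ x ∈ I, u x = R * (charData hl hr hrs).sol ((charData hl hr hrs).root k) x := by
  obtain ⟨j, hj, R, hR, hu, -⟩ := eigenfunction_shape hl hr hrs hla hlb h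
  rw [eig_eq hl hr hrs hla hlb] at hj
  rw [(strictMono_root_sq hl hr hrs).injective hj] at hu
  exact ⟨R, hR, hu⟩

/-! ### Nodal properties -/

theorem encard_arithmetic {s θ o : ℝ} (hs : s ≠ 0) (N : ℕ) :
    {x : ℝ | ∃ j : ℕ, j < N ∧ s * (x + 1) + θ = o + j * π}.encard = N := by
  have h : {x : ℝ | ∃ j : ℕ, j < N ∧ s * (x + 1) + θ = o + j * π} =
      (fun j : ℕ => (o + j * π - θ) / s - 1) '' (Finset.range N : Set ℕ) := by
    ext x
    simp only [mem_ofPred_eq, Finset.coe_range, mem_image, mem_Iio]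
    refine exists_congr fun j => and_congr_right fun _ => ?_
    rw [sub_eq_iff_eq_add, div_eq_iff hs]
    constructor <;> intro h <;> linarith
  rw [h, Function.Injective.encard_image, encard_coe_eq_coe_finsetCard, Finset.card_range]
  intro i j hij
  simp only [sub_left_inj] at hij
  rw [div_left_inj' hs, sub_left_inj, add_right_inj] at hij
  exact_mod_cast mul_right_cancel₀ pi_ne_zero hij

theorem sin_eq_zero_iff_nat {y : ℝ} {k : ℕ} (h0 : 0 < y) (h1 : y < (k + 1) * π) :
    sin y = 0 ↔ ∃ j : ℕ, j < k ∧ y = π + j * π := by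
  constructor
  · rw [sin_eq_zero_iff]
    rintro ⟨n, rfl⟩
    have e0 : 0 < n := by exact_mod_cast (mul_pos_iff_of_pos_right pi_pos).1 h0
    have e1 : n < k + 1 := by exact_mod_cast lt_of_mul_lt_mul_right h1 pi_pos.le
    obtain ⟨j, hj⟩ := Int.eq_ofNat_of_zero_le (show 0 ≤ n - 1 by omega)
    obtain rfl : n = j + 1 := by omega
    refine ⟨j, by omega, ?_⟩
    push_cast; ring
  · rintro ⟨j, -, rfl⟩
    rw [show π + j * π = ((j + 1 : ℕ) : ℝ) * π by push_cast; ring]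
    exact sin_nat_mul_pi _

theorem cos_eq_zero_iff_nat {y : ℝ} {k : ℕ} (h0 : 0 ≤ y) (h1 : y < (k + 1 / 2) * π) :
    cos y = 0 ↔ ∃ j : ℕ, j < k ∧ y = π / 2 + j * π := by
  constructor
  · rw [cos_eq_zero_iff]
    rintro ⟨n, rfl⟩
    have e0 : 0 ≤ n := by
      have : (0 : ℝ) ≤ 2 * n + 1 := by nlinarith [pi_pos]
      have : (0 : ℤ) ≤ 2 * n + 1 := by exact_mod_cast this
      omega
    have e1 : n < k := by
      have : (n : ℝ) < k := by nlinarith [pi_pos]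
      exact_mod_cast this
    obtain ⟨j, rfl⟩ := Int.eq_ofNat_of_zero_le e0
    refine ⟨j, by omega, ?_⟩
    push_cast; ring
  · rintro ⟨j, -, rfl⟩
    rw [cos_add_nat_mul_pi, cos_pi_div_two, mul_zero]

section Nodal

variable {m : ℕ} {d : CharData m} {s R : ℝ} {u : ℝ → ℝ}

theorem D_of_eq_sol (hu : ∀ x ∈ I, u x = R * d.sol s x) {x : ℝ} (hx : x ∈ I) :
    D u x = R * (s * d.cosol s x) := by
  rw [D_congr hu hx]
  exact D_eq_of_hasDerivAt hx ((d.hasDerivAt_sol s x).const_mul R)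

theorem D_D_of_eq_sol (hu : ∀ x ∈ I, u x = R * d.sol s x) {x : ℝ} (hx : x ∈ I) :
    D (D u) x = R * (s * -(s * d.sol s x)) := by
  rw [D_congr (fun y hy => D_of_eq_sol hu hy) hx]
  exact D_eq_of_hasDerivAt hx (((d.hasDerivAt_cosol s x).const_mul s).const_mul R)

theorem sol_sq_add_cosol_sq (x : ℝ) : d.sol s x ^ 2 + d.cosol s x ^ 2 = 1 :=
  sin_sq_add_cos_sq _

theorem th_pos_of_q_pos (hs : 0 ≤ s) (hs0 : s = 0 → d.p = 0) (hq : 0 < d.q) : 0 < d.th s := by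
  rcases hs.eq_or_lt with h | h
  · rw [CharData.th, hs0 h.symm, ang_zero_left]; positivity
  · exact ang_pos d.hp hq h

theorem mem_nodalS {l : BC} (hq : d.q = -l.b₀) (hs : 0 ≤ s)
    (hs0 : s = 0 → d.p = 0) {k : ℕ} (h1 : k * π < d.Ph s) (h2 : d.Ph s < (k + 1) * π)
    (hR : R ≠ 0) (hc : IsC2 u) (hu : ∀ x ∈ I, u x = R * d.sol s x) : u ∈ nodalS l k := by
  have hth := d.th_nonneg hs
  have hth2 := d.th_le s
  have hne : s ≠ 0 ∨ d.th s = π / 2 := by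
    by_cases h : s = 0
    · right; rw [CharData.th, hs0 h, ang_zero_left]
    · exact Or.inl h
  have hsol0 : d.sol s (-1) = sin (d.th s) := by simp [CharData.sol]
  have hsol1 : d.sol s 1 = sin (d.Ph s) := by
    rw [CharData.sol, CharData.Ph, one_add_one_eq_two]
  have hright : u 1 ≠ 0 := by
    rw [hu 1 one_mem_I, hsol1]
    refine mul_ne_zero hR fun h => ?_
    have h3 : sin (d.Ph s - k * π) = 0 := by rw [sin_sub_nat_mul_pi, h, mul_zero]
    exact (sin_pos_of_pos_of_lt_pi (x := d.Ph s - k * π) (by linarith) (by linarith)).ne' h3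
  have hsimple : SimpleZeros u (Ioo (-1) 1) k := by
    constructor
    · intro x hx h0 h0'
      have hx' := Ioo_subset_Icc_self hx
      rw [hu x hx'] at h0
      rw [D_of_eq_sol hu hx'] at h0'
      have e0 := (mul_eq_zero.1 h0).resolve_left hR
      have e1 := (mul_eq_zero.1 h0').resolve_left hR
      rcases mul_eq_zero.1 e1 with e2 | e2
      · have e3 := hne.resolve_left (by simpa using e2)
        rw [CharData.sol, e3, e2] at e0
        norm_num at e0
      · have := sol_sq_add_cosol_sq (d := d) (s := s) x
        rw [e0, e2] at this; norm_num at this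
    -- At s = 0 the solution is constant with phase π/2, which forces k = 0 and leaves no zeros. For
    -- s > 0 the zeros are the points of phase π, 2π, …, kπ.
    · by_cases h : s = 0
      · have e3 := hne.resolve_left (by simpa using h)
        have hk : k = 0 := by
          rw [CharData.Ph, e3, h] at h1
          by_contra hk0
          have : (1 : ℝ) ≤ k := by exact_mod_cast Nat.one_le_iff_ne_zero.2 hk0
          nlinarith [pi_pos]
        subst hk
        rw [Nat.cast_zero, encard_eq_zero]
        refine eq_empty_of_forall_notMem fun x hx => ?_
        have := hx.2
        rw [hu x (Ioo_subset_Icc_self hx.1), CharData.sol, e3, h] at this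
        simp [hR] at this
      · have hs1 : 0 < s := lt_of_le_of_ne hs (Ne.symm h)
        rw [← encard_arithmetic (θ := d.th s) (o := π) h k]
        congr 1
        ext x
        simp only [mem_ofPred_eq]
        constructor
        · rintro ⟨hx, h0⟩
          rw [hu x (Ioo_subset_Icc_self hx)] at h0
          have e0 := (mul_eq_zero.1 h0).resolve_left hR
          refine (sin_eq_zero_iff_nat ?_ ?_).1 e0
          · have := mul_pos hs1 (show 0 < x + 1 by linarith [hx.1])
            linarith
          · have := mul_lt_mul_of_pos_left (show x + 1 < 2 by linarith [hx.2]) hs1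
            unfold CharData.Ph at h2
            linarith
        · rintro ⟨j, hj, h0⟩
          have hjk : (j + 1 : ℝ) ≤ k := by exact_mod_cast hj
          have hj0 : (0 : ℝ) ≤ j := j.cast_nonneg
          have e1 : 0 < s * (x + 1) := by nlinarith [pi_pos]
          have e2 : s * (x + 1) < s * 2 := by
            unfold CharData.Ph at h1
            nlinarith [mul_le_mul_of_nonneg_right hjk pi_pos.le]
          have hx : x ∈ Ioo (-1 : ℝ) 1 :=
            ⟨by linarith [(mul_pos_iff_of_pos_left hs1).1 e1],
              by linarith [lt_of_mul_lt_mul_left e2 hs]⟩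
          refine ⟨hx, ?_⟩
          rw [hu x (Ioo_subset_Icc_self hx), CharData.sol, h0,
            show π + j * π = ((j + 1 : ℕ) : ℝ) * π by push_cast; ring, sin_nat_mul_pi, mul_zero]
  by_cases hb : l.b₀ = 0
  · left
    have hq0 : d.q = 0 := by rw [hq, hb, neg_zero]
    have hp0 : d.p ≠ 0 := by have := d.hpq; rw [hq0, add_zero] at this; exact this.ne'
    have hs1 : s ≠ 0 := fun h => hp0 (hs0 h)
    have hth0 : d.th s = 0 := by simp [CharData.th, ang, hp0, hq0]
    refine ⟨hb, hc, ?_, ?_, hright, hsimple⟩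
    · rw [hu _ neg_one_mem_I, hsol0, hth0, sin_zero, mul_zero]
    · rw [D_of_eq_sol hu neg_one_mem_I]
      refine mul_ne_zero hR (mul_ne_zero hs1 ?_)
      simp [CharData.cosol, hth0]
  · right
    have hq0 : 0 < d.q := lt_of_le_of_ne d.hq fun h => hb (by linarith)
    refine ⟨hb, hc, ?_, hright, hsimple⟩
    rw [hu _ neg_one_mem_I, hsol0]
    exact mul_ne_zero hR (sin_pos_of_pos_of_lt_pi (th_pos_of_q_pos hs hs0 hq0)
      (by linarith [pi_pos])).ne'

/-- The zeros of u' are the points of phase π/2 + jπ with j = 0, …, k, counted on [-1, 1). The first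
of them is the end point -1 exactly when θ = π/2, the Neumann case; otherwise deleting -1 changes
nothing. -/
theorem mem_nodalT {l : BC} (hp : d.p = l.a₀) (hs : 0 < s)
    {k : ℕ} (h1 : (k + 1 / 2) * π < d.Ph s) (h2 : d.Ph s < (k + 3 / 2) * π)
    (hR : R ≠ 0) (hc : IsC2 u) (hu : ∀ x ∈ I, u x = R * d.sol s x) : u ∈ nodalT l (k + 1) := by
  have hth := d.th_nonneg hs.le
  have hth2 := d.th_le s
  have hD : ∀ x ∈ I, D u x = 0 ↔ cos (s * (x + 1) + d.th s) = 0 := fun x hx => by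
    rw [D_of_eq_sol hu hx, mul_eq_zero, mul_eq_zero, or_iff_right hR, or_iff_right hs.ne']; rfl
  have hnat : ∀ x ∈ Ico (-1 : ℝ) 1, D u x = 0 ↔
      ∃ j : ℕ, j < k + 1 ∧ s * (x + 1) + d.th s = π / 2 + j * π := fun x hx => by
    rw [hD x (Ico_subset_Icc_self hx)]
    refine cos_eq_zero_iff_nat ?_ ?_
    · have := mul_nonneg hs.le (show 0 ≤ x + 1 by linarith [hx.1])
      linarith
    · have := mul_lt_mul_of_pos_left (show x + 1 < 2 by linarith [hx.2]) hs
      unfold CharData.Ph at h2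
      push_cast
      linarith
  have hIco : ∀ (x : ℝ) (j : ℕ), j < k + 1 → s * (x + 1) + d.th s = π / 2 + j * π →
      x ∈ Ico (-1 : ℝ) 1 := fun x j hj h0 => by
    have hjk : (j : ℝ) ≤ k := by exact_mod_cast Nat.lt_succ_iff.1 hj
    have hj0 : (0 : ℝ) ≤ j := j.cast_nonneg
    have e1 : 0 ≤ s * (x + 1) := by nlinarith [pi_pos]
    have e2 : s * (x + 1) < s * 2 := by
      unfold CharData.Ph at h1
      nlinarith [mul_le_mul_of_nonneg_right hjk pi_pos.le]
    exact ⟨by linarith [(mul_nonneg_iff_of_pos_left hs).1 e1],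
      by linarith [lt_of_mul_lt_mul_left e2 hs.le]⟩
  have hright : D u 1 ≠ 0 := fun h => by
    rw [hD 1 one_mem_I, one_add_one_eq_two] at h
    change cos (d.Ph s) = 0 at h
    have h3 : cos (d.Ph s - (k + 1 : ℕ) * π) = 0 := by rw [cos_sub_nat_mul_pi, h, mul_zero]
    exact (cos_pos_of_mem_Ioo (x := d.Ph s - (k + 1 : ℕ) * π)
      ⟨by push_cast; linarith, by push_cast; linarith⟩).ne' h3
  have hsimple : ∀ x ∈ Ico (-1 : ℝ) 1, D u x = 0 → D (D u) x ≠ 0 := fun x hx h0 h0' => by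
    have hx' := Ico_subset_Icc_self hx
    have e0 : d.cosol s x = 0 := (hD x hx').1 h0
    rw [D_D_of_eq_sol hu hx'] at h0'
    have e1 : d.sol s x = 0 := by simpa [hR, hs.ne'] using h0'
    have := sol_sq_add_cosol_sq (d := d) (s := s) x
    rw [e0, e1] at this; norm_num at this
  have hcard : {x | x ∈ Ico (-1 : ℝ) 1 ∧ D u x = 0}.encard = (k + 1 : ℕ) := by
    rw [← encard_arithmetic (θ := d.th s) (o := π / 2) hs.ne' (k + 1)]
    congr 1
    ext x
    simp only [mem_ofPred_eq]
    constructor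
    · rintro ⟨hx, h0⟩
      exact (hnat x hx).1 h0
    · rintro ⟨j, hj, h0⟩
      exact ⟨hIco x j hj h0, (hnat x (hIco x j hj h0)).2 ⟨j, hj, h0⟩⟩
  have hzero : ZeroBetween u (Ico (-1) 1) := by
    intro x hx y hy hxy hx0 hy0 _
    obtain ⟨i, hi, ex⟩ := (hnat x hx).1 hx0
    obtain ⟨j, hj, ey⟩ := (hnat y hy).1 hy0
    have hsxy := mul_lt_mul_of_pos_left hxy hs
    have hij : (i : ℝ) < j := by nlinarith [pi_pos]
    have hij' : (i + 1 : ℝ) ≤ j := by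
      have : i < j := by exact_mod_cast hij
      exact_mod_cast this
    have hijπ := mul_le_mul_of_nonneg_right hij' pi_pos.le
    -- The phase (i+1)π lies strictly between π/2 + iπ and π/2 + jπ as soon as i < j, so the two
    -- zeros of u' need not be consecutive.
    obtain ⟨z, hz⟩ : ∃ z, s * (z + 1) + d.th s = (i + 1 : ℕ) * π :=
      ⟨((i + 1 : ℕ) * π - d.th s) / s - 1, by field_simp; ring⟩
    have hz' : z ∈ Ioo x y := by
      push_cast at hz
      exact ⟨lt_of_mul_lt_mul_left (a := s) (by linarith [pi_pos]) hs.le,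
        lt_of_mul_lt_mul_left (a := s) (by linarith [pi_pos]) hs.le⟩
    refine ⟨z, hz', ?_⟩
    rw [hu z ⟨by linarith [hx.1, hz'.1], by linarith [hy.2, hz'.2]⟩, CharData.sol, hz,
      sin_nat_mul_pi, mul_zero]
  by_cases ha : l.a₀ = 0
  · left
    refine ⟨ha, hc, ?_, hright, ⟨hsimple, hcard⟩, hzero⟩
    rw [hD _ neg_one_mem_I, CharData.th, hp, ha, ang_zero_left]
    simp
  · right
    have hleft : D u (-1) ≠ 0 := by
      rw [Ne, hD _ neg_one_mem_I, neg_add_cancel, mul_zero, zero_add]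
      have hlt : d.th s < π / 2 := ang_lt (by rwa [hp]) _ _
      exact (cos_pos_of_mem_Ioo ⟨by linarith [pi_pos], hlt⟩).ne'
    refine ⟨ha, hc, hleft, hright, ⟨fun x hx => hsimple x (Ioo_subset_Ico_self hx), ?_⟩,
      fun x hx y hy => hzero x (Ioo_subset_Ico_self hx) y (Ioo_subset_Ico_self hy)⟩
    rw [← hcard]
    congr 1
    ext x
    refine ⟨fun h => ⟨Ioo_subset_Ico_self h.1, h.2⟩, fun h => ⟨⟨lt_of_le_of_ne h.1.1 ?_, h.1.2⟩, h.2⟩⟩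
    rintro rfl
    exact hleft h.2

end Nodal

/-! ### The single-point problems -/

theorem admissible_dirichlet : dirichlet.Admissible 1 :=
  ⟨fun i => i.elim0, fun i => i.elim0, zero_le_one, by simp [dirichlet, singlePoint],
    by simp [dirichlet, singlePoint]⟩

theorem admissible_neumann : neumann.Admissible 1 :=
  ⟨fun i => i.elim0, fun i => i.elim0, le_rfl, by simp [neumann, singlePoint],
    by simp [neumann, singlePoint]⟩

theorem strongBound_singlePoint (a b : ℝ) : (singlePoint a b).StrongBound := by
  refine ⟨fun _ => ?_, fun _ => ?_, ?_⟩ <;> simp [singlePoint]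

theorem BC.Admissible.single {l : BC} (hl : l.Admissible (-1)) :
    (singlePoint l.a₀ l.b₀).Admissible (-1) :=
  ⟨fun i => i.elim0, fun i => i.elim0, hl.nonneg, hl.nondegenerate, hl.sign⟩

theorem spectrumListed_dirichlet {l : BC} (hl : l.Admissible (-1)) :
    SpectrumListed (singlePoint l.a₀ l.b₀) dirichlet :=
  spectrumListed hl.single admissible_dirichlet (strongBound_singlePoint 1 0)
    (fun _ => rfl) (fun _ => rfl)

theorem spectrumListed_neumann {l : BC} (hl : l.Admissible (-1)) :
    SpectrumListed (singlePoint l.a₀ l.b₀) neumann :=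
  spectrumListed hl.single admissible_neumann (strongBound_singlePoint 0 1)
    (fun _ => rfl) (fun _ => rfl)

theorem eq_of_sin_eq_zero_of_mem_window {y : ℝ} {k : ℕ} (h : sin y = 0)
    (hy : y ∈ CharData.window k) : y = (k + 1) * π := by
  have h1 : sin (y - (k + 1 : ℕ) * π) = 0 := by rw [sin_sub_nat_mul_pi, h, mul_zero]
  have h2 := hy.1
  have h3 := hy.2
  have := (sin_eq_zero_iff_of_lt_of_lt (by push_cast; linarith [pi_pos])
    (by push_cast; linarith [pi_pos])).1 h1
  push_cast at this
  linarith

/-! ### Single-point eigenvalues in terms of the end phase, and the critical index. -/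

section Compare

variable {l r : BC}

/-- The end phase depends only on the left condition, so the Dirichlet problem shares it with the
multi-point problem. There δ = 0 and `G` is just sin Ψ, whose only zero in window k is at (k+1)π. -/
theorem eigRD_eq (hl : l.Admissible (-1)) (hr : r.Admissible 1) (hrs : r.StrongBound) (k : ℕ) :
    ∃ t, 0 ≤ t ∧ eigRD l k = t ^ 2 ∧ (charData hl hr hrs).Ph t = (k + 1) * π := by
  set e := charData hl.single admissible_dirichlet (strongBound_singlePoint 1 0) with he
  refine ⟨e.root k, e.root_nonneg k,
    eig_eq hl.single admissible_dirichlet (strongBound_singlePoint 1 0)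
      (fun _ => rfl) (fun _ => rfl) k, ?_⟩
  have hG : sin (e.Ps (e.root k)) - 0 = 0 := e.G_root k
  have h1 := eq_of_sin_eq_zero_of_mem_window (by linarith) (e.Ps_root k)
  have h2 : e.de (e.root k) = 0 := by
    simp [CharData.de, he, charData, dirichlet, singlePoint, ang]
  rw [CharData.Ps, h2, add_zero] at h1
  exact h1

/-- Same comparison with δ = π/2, which lowers the end phase by π/2. -/
theorem eigRN_eq (hl : l.Admissible (-1)) (hr : r.Admissible 1) (hrs : r.StrongBound) (k : ℕ) :
    ∃ t, 0 ≤ t ∧ eigRN l k = t ^ 2 ∧ (charData hl hr hrs).Ph t = (k + 1 / 2) * π := by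
  set e := charData hl.single admissible_neumann (strongBound_singlePoint 0 1) with he
  refine ⟨e.root k, e.root_nonneg k,
    eig_eq hl.single admissible_neumann (strongBound_singlePoint 0 1)
      (fun _ => rfl) (fun _ => rfl) k, ?_⟩
  have hG : sin (e.Ps (e.root k)) - 0 = 0 := e.G_root k
  have h1 := eq_of_sin_eq_zero_of_mem_window (by linarith) (e.Ps_root k)
  have h2 : e.de (e.root k) = π / 2 := by
    simp [CharData.de, he, charData, neumann, singlePoint]
  rw [CharData.Ps, h2] at h1
  change e.Ph (e.root k) = _
  linarith

theorem eigRD_pos (hl : l.Admissible (-1)) (k : ℕ) : 0 < eigRD l k := by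
  obtain ⟨t, ht, h, hP⟩ := eigRD_eq hl admissible_dirichlet (strongBound_singlePoint 1 0) k
  rw [h]
  refine pow_pos (lt_of_le_of_ne ht fun h0 => ?_) 2
  have h1 := CharData.th_le (charData hl admissible_dirichlet (strongBound_singlePoint 1 0)) t
  rw [CharData.Ph, ← h0] at hP
  rw [← h0] at h1
  have : (0 : ℝ) ≤ k := k.cast_nonneg
  nlinarith [pi_pos]

theorem eigRD_strictMono (hl : l.Admissible (-1)) : StrictMono (eigRD l) :=
  (spectrumListed_dirichlet hl).1

theorem eigRDInt_natCast (l : BC) (k : ℕ) : eigRDInt l k = eigRD l k := by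
  simp [eigRDInt]

theorem eigRDInt_monotone (hl : l.Admissible (-1)) : Monotone (eigRDInt l) := by
  intro m n h
  unfold eigRDInt
  split_ifs with h1 h2 h2
  · exact le_rfl
  · exact (eigRD_pos hl _).le
  · omega
  · exact (eigRD_strictMono hl).monotone (Int.toNat_le_toNat h)

theorem eigRDInt_nonneg (hl : l.Admissible (-1)) (n : ℤ) : 0 ≤ eigRDInt l n := by
  unfold eigRDInt
  split_ifs
  · exact le_rfl
  · exact (eigRD_pos hl _).le

theorem J_of_ne {r : BC} (h : r.b₀ ≠ 0) : r.J = (((r.a₀ / r.b₀) ^ 2 : ℝ) : EReal) := if_neg h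

theorem J_eq_top_iff {r : BC} : r.J = ⊤ ↔ r.b₀ = 0 := by
  refine ⟨fun h => by_contra fun hb => ?_, fun h => if_pos h⟩
  rw [J_of_ne hb] at h
  exact EReal.coe_ne_top _ h

theorem existsUnique_criticalIndex (hl : l.Admissible (-1)) :
    ∃! kc : WithTop ℤ, IsCriticalIndex l r kc := by
  by_cases hb : r.b₀ = 0
  · have hJ := J_eq_top_iff.2 hb
    refine ⟨⊤, Or.inl ⟨hJ, rfl⟩, ?_⟩
    rintro kc (⟨-, h⟩ | ⟨h, -⟩ | ⟨n, -, -, -, h⟩)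
    · exact h
    · rw [hJ] at h; exact absurd h EReal.top_ne_zero
    · rw [hJ, top_le_iff] at h; exact absurd h (EReal.coe_ne_top _)
  · have hJ := J_of_ne hb
    by_cases h0 : r.J = 0
    · refine ⟨_, Or.inr (Or.inl ⟨h0, rfl⟩), ?_⟩
      rintro kc (⟨h, -⟩ | ⟨-, h⟩ | ⟨n, -, -, h, -⟩)
      · rw [hJ] at h; exact absurd h (EReal.coe_ne_top _)
      · exact h
      · rw [h0] at h
        exact absurd (EReal.coe_lt_coe_iff.1 h) (not_lt.2 (eigRDInt_nonneg hl n))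
    · have hj0 : 0 < (r.a₀ / r.b₀) ^ 2 :=
        lt_of_le_of_ne (sq_nonneg _) fun h => h0 (by rw [hJ, ← h]; rfl)
      have hex : ∃ n, (r.a₀ / r.b₀) ^ 2 ≤ eigRD l n :=
        ((spectrumListed_dirichlet hl).2.2.eventually_ge_atTop _).exists
      classical
      -- The index is one less than the first Dirichlet eigenvalue reaching J. It is -1 when that is
      -- number 0, and then the strict lower bound is J > 0.
      refine ⟨((Nat.find hex - 1 : ℤ) : WithTop ℤ), Or.inr (Or.inr ⟨_, rfl, by omega, ?_, ?_⟩), ?_⟩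
      · rw [hJ, EReal.coe_lt_coe_iff]
        rcases Nat.eq_zero_or_pos (Nat.find hex) with h | h
        · rw [h, eigRDInt, if_pos (by norm_num)]; exact hj0
        · have h1 := not_le.1 (Nat.find_min hex (Nat.sub_lt h one_pos))
          rw [show (Nat.find hex : ℤ) - 1 = ((Nat.find hex - 1 : ℕ) : ℤ) by omega,
            eigRDInt_natCast]
          exact h1
      · rw [hJ, EReal.coe_le_coe_iff, sub_add_cancel, eigRDInt_natCast]
        exact Nat.find_spec hex
      · rintro kc (⟨h, -⟩ | ⟨h, -⟩ | ⟨n, rfl, hn, h1, h2⟩)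
        · rw [hJ] at h; exact absurd h (EReal.coe_ne_top _)
        · exact absurd h h0
        · rw [hJ, EReal.coe_lt_coe_iff] at h1
          rw [hJ, EReal.coe_le_coe_iff] at h2
          have h3 : Nat.find hex ≤ (n + 1).toNat := by
            refine Nat.find_min' hex ?_
            rwa [← eigRDInt_natCast, Int.toNat_of_nonneg (by omega)]
          have h4 : n < Nat.find hex := by
            by_contra! hle
            have := eigRDInt_monotone hl hle
            rw [eigRDInt_natCast] at this
            linarith [Nat.find_spec hex]
          congr 1
          omega

theorem mul_le_of_sq_lt_J (hr : r.Admissible 1) {t : ℝ}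
    (h : ((t ^ 2 : ℝ) : EReal) < r.J) : r.b₀ * t ≤ r.a₀ := by
  rcases hr.b₀_nonneg.eq_or_lt with hb | hb
  · rw [← hb, zero_mul]; exact hr.nonneg
  · rw [J_of_ne hb.ne', EReal.coe_lt_coe_iff] at h
    have := lt_of_pow_lt_pow_left₀ 2 (div_nonneg hr.nonneg hb.le) h
    rw [lt_div_iff₀ hb] at this
    linarith

theorem le_mul_of_J_le_sq (hr : r.Admissible 1) {t : ℝ} (ht : 0 ≤ t)
    (h : r.J ≤ ((t ^ 2 : ℝ) : EReal)) : r.a₀ ≤ r.b₀ * t := by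
  rcases hr.b₀_nonneg.eq_or_lt with hb | hb
  · rw [J_eq_top_iff.2 hb.symm, top_le_iff] at h
    exact absurd h (EReal.coe_ne_top _)
  · rw [J_of_ne hb.ne', EReal.coe_le_coe_iff] at h
    have := le_of_sq_le_sq h ht
    rw [div_le_iff₀ hb] at this
    linarith

theorem eigRD_lt_J (hl : l.Admissible (-1)) {kc : WithTop ℤ} (hkc : IsCriticalIndex l r kc)
    {k : ℕ} (hk : ((k : ℤ) : WithTop ℤ) ≤ kc) : (eigRD l k : EReal) < r.J := by
  rcases hkc with ⟨h, -⟩ | ⟨-, rfl⟩ | ⟨n, rfl, -, h, -⟩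
  · rw [h]; exact EReal.coe_lt_top _
  · have := WithTop.coe_le_coe.1 hk; omega
  · refine lt_of_le_of_lt ?_ h
    rw [EReal.coe_le_coe_iff, ← eigRDInt_natCast]
    exact eigRDInt_monotone hl (WithTop.coe_le_coe.1 hk)

theorem J_le_eigRD (hl : l.Admissible (-1)) {kc : WithTop ℤ} (hkc : IsCriticalIndex l r kc)
    {k : ℕ} (hk : kc + ((1 : ℤ) : WithTop ℤ) ≤ ((k : ℤ) : WithTop ℤ)) :
    r.J ≤ (eigRD l k : EReal) := by
  rcases hkc with ⟨-, rfl⟩ | ⟨h, -⟩ | ⟨n, rfl, -, -, h⟩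
  · rw [WithTop.top_add, top_le_iff] at hk
    exact absurd hk (WithTop.coe_ne_top)
  · rw [h]; exact EReal.coe_nonneg.2 (eigRD_pos hl k).le
  · refine h.trans ?_
    rw [EReal.coe_le_coe_iff, ← eigRDInt_natCast]
    rw [← WithTop.coe_add] at hk
    exact eigRDInt_monotone hl (WithTop.coe_le_coe.1 hk)

end Compare

/-! ### Localization of the eigenvalues relative to the resonance. -/

section Localization

variable {l r : BC}

theorem eig_lt_of_Ph_lt {k : ℕ} {t μ : ℝ} (hl : l.Admissible (-1)) (hr : r.Admissible 1)
    (hrs : r.StrongBound) (hla : ∀ i, l.a i = 0) (hlb : ∀ i, l.b i = 0) (hμ : μ = t ^ 2)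
    (h : (charData hl hr hrs).Ph ((charData hl hr hrs).root k) <
      (charData hl hr hrs).Ph t) : eig l r k < μ := by
  rw [eig_eq hl hr hrs hla hlb, hμ]
  exact pow_lt_pow_left₀ ((charData hl hr hrs).Ph_strictMono.lt_iff_lt.1 h)
    ((charData hl hr hrs).root_nonneg k) two_ne_zero

theorem lt_eig_of_lt_Ph {k : ℕ} {t μ : ℝ} (hl : l.Admissible (-1)) (hr : r.Admissible 1)
    (hrs : r.StrongBound) (hla : ∀ i, l.a i = 0) (hlb : ∀ i, l.b i = 0) (hμ : μ = t ^ 2)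
    (ht : 0 ≤ t) (h : (charData hl hr hrs).Ph t <
      (charData hl hr hrs).Ph ((charData hl hr hrs).root k)) : μ < eig l r k := by
  rw [eig_eq hl hr hrs hla hlb, hμ]
  exact pow_lt_pow_left₀ ((charData hl hr hrs).Ph_strictMono.lt_iff_lt.1 h) ht two_ne_zero

/-- Below the resonance, the eigenvalues interlace with the Neumann eigenvalues. -/
theorem nodalT_of_eigRD_lt_J (hl : l.Admissible (-1)) (hr : r.Admissible 1)
    (hrs : r.StrongBound) (hla : ∀ i, l.a i = 0) (hlb : ∀ i, l.b i = 0) {k : ℕ}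
    (hJ : (eigRD l (k + 1) : EReal) < r.J) :
    (∀ ψ, IsEigenfunction l r (eig l r k) ψ → ψ ∈ nodalT l (k + 1)) ∧
      eigRN l k < eig l r k ∧ eig l r k < eigRN l (k + 1) := by
  obtain ⟨t, ht, ht2, htP⟩ := eigRD_eq hl hr hrs (k + 1)
  obtain ⟨n₀, hn₀, hn₀2, hn₀P⟩ := eigRN_eq hl hr hrs k
  obtain ⟨n₁, hn₁, hn₁2, hn₁P⟩ := eigRN_eq hl hr hrs (k + 1)
  have hshape := fun ψ (h : IsEigenfunction l r (eig l r k) ψ) =>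
    eigenfunction_eig_shape hl hr hrs hla hlb h
  have hlt := fun (h : (charData hl hr hrs).Ph ((charData hl hr hrs).root k) <
    (charData hl hr hrs).Ph n₁) => eig_lt_of_Ph_lt hl hr hrs hla hlb hn₁2 h
  have hgt := fun (h : (charData hl hr hrs).Ph n₀ <
    (charData hl hr hrs).Ph ((charData hl hr hrs).root k)) =>
      lt_eig_of_lt_Ph hl hr hrs hla hlb hn₀2 hn₀ h
  have hQt : (charData hl hr hrs).Q * t ≤ (charData hl hr hrs).P := by
    rw [ht2] at hJ
    exact mul_le_of_sq_lt_J hr hJ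
  have hp : (charData hl hr hrs).p = l.a₀ := rfl
  generalize charData hl hr hrs = d at *
  have hs := d.root_nonneg k
  have hwin := d.Ps_root k
  have hup : d.Ph (d.root k) < (k + 3 / 2) * π := by
    have := hwin.2
    have := d.de_nonneg hs
    unfold CharData.Ps at *
    linarith
  push_cast at htP hn₁P
  -- The window alone gives Φ < (k+3/2)π < (k+2)π, so the root precedes Dirichlet root k+1 and, with
  -- it, the resonance.
  have hst : d.root k < t := by
    rw [← d.Ph_strictMono.lt_iff_lt, htP]; linarith [pi_pos]
  have hPQ : d.Q * d.root k ≤ d.P := (mul_le_mul_of_nonneg_left hst.le d.hQ).trans hQt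
  have hs0 : 0 < d.root k := by
    refine lt_of_le_of_ne hs fun h => ?_
    obtain ⟨-, -, hP⟩ := (d.root_eq_zero_iff k).1 h.symm
    have hQ := d.hPQ
    rw [hP, zero_add] at hQ
    rw [hP] at hQt
    have := mul_pos hQ (hs.trans_lt hst)
    linarith
  have hlow := d.lt_Ph_of_le hs0 (d.G_root k) hwin hPQ
  refine ⟨fun ψ hψ => ?_, hgt (by rw [hn₀P]; exact hlow), hlt (by rw [hn₁P]; linarith)⟩
  obtain ⟨R, hR, hu⟩ := hshape ψ hψ
  exact mem_nodalT hp hs0 hlow hup hR hψ.c2 hu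

/-- Above the resonance, the eigenvalues interlace with the Dirichlet eigenvalues. -/
theorem nodalS_of_le (hl : l.Admissible (-1)) (hr : r.Admissible 1)
    (hrs : r.StrongBound) (hla : ∀ i, l.a i = 0) (hlb : ∀ i, l.b i = 0) {k : ℕ}
    (hPQ : (charData hl hr hrs).P ≤
      (charData hl hr hrs).Q * (charData hl hr hrs).root k ∨
      (charData hl hr hrs).Ph ((charData hl hr hrs).root k) < (k + 1) * π) :
    (∀ ψ, IsEigenfunction l r (eig l r k) ψ → ψ ∈ nodalS l k) ∧
      eig l r k < eigRD l k := by
  obtain ⟨t, ht, ht2, htP⟩ := eigRD_eq hl hr hrs k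
  have hshape := fun ψ (h : IsEigenfunction l r (eig l r k) ψ) =>
    eigenfunction_eig_shape hl hr hrs hla hlb h
  have hlt := fun (h : (charData hl hr hrs).Ph ((charData hl hr hrs).root k) <
    (charData hl hr hrs).Ph t) => eig_lt_of_Ph_lt hl hr hrs hla hlb ht2 h
  have hq : (charData hl hr hrs).q = -l.b₀ := rfl
  generalize charData hl hr hrs = d at *
  have hs := d.root_nonneg k
  have hwin := d.Ps_root k
  have hlow : k * π < d.Ph (d.root k) := by
    have := hwin.1
    have := d.de_le (d.root k)
    unfold CharData.Ps at *
    linarith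
  have hup : d.Ph (d.root k) < (k + 1) * π := by
    rcases hs.eq_or_lt with h0 | h0
    · obtain ⟨hk, hp0, hP0⟩ := (d.root_eq_zero_iff k).1 h0.symm
      rw [← h0, CharData.Ph, CharData.th, hp0, ang_zero_left, hk]
      push_cast
      linarith [pi_pos]
    · rcases hPQ with h | h
      · exact d.Ph_lt_of_le h0 (d.G_root k) hwin h
      · exact h
  refine ⟨fun ψ hψ => ?_, hlt (by rw [htP]; exact hup)⟩
  obtain ⟨R, hR, hu⟩ := hshape ψ hψ
  exact mem_nodalS hq hs (fun h => ((d.root_eq_zero_iff k).1 h).2.1) hlow hup hR hψ.c2 hu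

theorem nodalS_succ_of_J_le (hl : l.Admissible (-1)) (hr : r.Admissible 1)
    (hrs : r.StrongBound) (hla : ∀ i, l.a i = 0) (hlb : ∀ i, l.b i = 0) {k : ℕ}
    (hJ : r.J ≤ (eigRD l k : EReal)) :
    (∀ ψ, IsEigenfunction l r (eig l r (k + 1)) ψ → ψ ∈ nodalS l (k + 1)) ∧
      eigRD l k < eig l r (k + 1) ∧ eig l r (k + 1) < eigRD l (k + 1) := by
  obtain ⟨t, ht, ht2, htP⟩ := eigRD_eq hl hr hrs k
  -- Window k+1 starts at (k+3/2)π and δ ≤ π/2, so this lower bound holds on both sides of the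
  -- resonance; it places the root beyond Dirichlet root k, hence above the resonance.
  have hlow : (k + 1) * π < (charData hl hr hrs).Ph ((charData hl hr hrs).root (k + 1)) := by
    have h1 := ((charData hl hr hrs).Ps_root (k + 1)).1
    have h2 := (charData hl hr hrs).de_le ((charData hl hr hrs).root (k + 1))
    unfold CharData.Ps at h1
    push_cast at h1
    linarith
  rw [← htP] at hlow
  have hst := (charData hl hr hrs).Ph_strictMono.lt_iff_lt.1 hlow
  rw [ht2] at hJ
  obtain ⟨h1, h2⟩ := nodalS_of_le hl hr hrs hla hlb (k := k + 1) (Or.inl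
    ((le_mul_of_J_le_sq hr ht hJ).trans (mul_le_mul_of_nonneg_left hst.le hr.b₀_nonneg)))
  exact ⟨h1, lt_eig_of_lt_Ph hl hr hrs hla hlb ht2 ht hlow, h2⟩

theorem nodalS_zero_of_J_le (hl : l.Admissible (-1)) (hr : r.Admissible 1)
    (hrs : r.StrongBound) (hla : ∀ i, l.a i = 0) (hlb : ∀ i, l.b i = 0)
    (hJ : r.J ≤ (eigRD l 0 : EReal)) :
    (∀ ψ, IsEigenfunction l r (eig l r 0) ψ → ψ ∈ nodalS l 0) ∧ eig l r 0 < eigRD l 0 := by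
  obtain ⟨t, ht, ht2, htP⟩ := eigRD_eq hl hr hrs 0
  rw [ht2] at hJ
  refine nodalS_of_le hl hr hrs hla hlb ?_
  -- No preceding Dirichlet eigenvalue is available for k = 0. Either the root lies beyond Dirichlet
  -- root 0, hence above the resonance, or it lies before it and the phase bound is immediate.
  rcases le_or_gt t ((charData hl hr hrs).root 0) with h | h
  · exact Or.inl ((le_mul_of_J_le_sq hr ht hJ).trans
      (mul_le_mul_of_nonneg_left h hr.b₀_nonneg))
  · right
    rw [← htP]
    exact (charData hl hr hrs).Ph_strictMono h

end Localization

end MultiPoint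

end

theorem mainTheorem5 (l r : MultiPoint.BC)
    (hl : l.Admissible (-1)) (hr : r.Admissible 1)
    (hla : ∀ i, l.a i = 0) (hlb : ∀ i, l.b i = 0)
    (hrs : r.StrongBound) :
    -- the eigenvalue sequences and the critical index are well defined
    MultiPoint.SpectrumListed l r ∧
    MultiPoint.SpectrumListed (MultiPoint.singlePoint l.a₀ l.b₀) MultiPoint.dirichlet ∧
    MultiPoint.SpectrumListed (MultiPoint.singlePoint l.a₀ l.b₀) MultiPoint.neumann ∧
    (∃! kc : WithTop ℤ, MultiPoint.IsCriticalIndex l r kc) ∧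
    ∀ kc : WithTop ℤ, MultiPoint.IsCriticalIndex l r kc →
      (∀ k : ℕ, ((k + 1 : ℤ) : WithTop ℤ) ≤ kc →
        (∀ ψ, MultiPoint.IsEigenfunction l r (MultiPoint.eig l r k) ψ →
          ψ ∈ MultiPoint.nodalT l (k + 1)) ∧
        MultiPoint.eigRN l k < MultiPoint.eig l r k ∧
        MultiPoint.eig l r k < MultiPoint.eigRN l (k + 1)) ∧
      (∀ k : ℕ, kc + ((2 : ℤ) : WithTop ℤ) ≤ ((k : ℤ) : WithTop ℤ) →
        (∀ ψ, MultiPoint.IsEigenfunction l r (MultiPoint.eig l r k) ψ →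
          ψ ∈ MultiPoint.nodalS l k) ∧
        MultiPoint.eigRDInt l (k - 1) < MultiPoint.eig l r k ∧
        MultiPoint.eig l r k < MultiPoint.eigRD l k) ∧
      (kc = ((-1 : ℤ) : WithTop ℤ) →
        (∀ ψ, MultiPoint.IsEigenfunction l r (MultiPoint.eig l r 0) ψ →
          ψ ∈ MultiPoint.nodalS l 0) ∧
        0 ≤ MultiPoint.eig l r 0 ∧
        (MultiPoint.eig l r 0 = 0 ↔ l.a₀ = 0 ∧ r.a₀ = 0) ∧
        MultiPoint.eig l r 0 < MultiPoint.eigRD l 0 ∧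
        ∀ k : ℕ, ∀ ψ, MultiPoint.IsEigenfunction l r (MultiPoint.eig l r k) ψ →
          ψ ∈ MultiPoint.nodalS l k) := by
  refine ⟨MultiPoint.spectrumListed hl hr hrs hla hlb, MultiPoint.spectrumListed_dirichlet hl,
    MultiPoint.spectrumListed_neumann hl, MultiPoint.existsUnique_criticalIndex hl,
    fun kc hkc => ⟨fun k hk => ?_, fun k hk => ?_, ?_⟩⟩
  · exact MultiPoint.nodalT_of_eigRD_lt_J hl hr hrs hla hlb
      (MultiPoint.eigRD_lt_J hl hkc (by exact_mod_cast hk))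
  -- Because the critical index is at least -1, `k ≥ kc + 2` forces k ≥ 1, so the preceding
  -- Dirichlet index is a natural number.
  · have hkc1 : ∃ j : ℕ, k = j + 1 ∧ kc + ((1 : ℤ) : WithTop ℤ) ≤ ((j : ℤ) : WithTop ℤ) := by
      induction kc using WithTop.recTopCoe with
      | top =>
        rw [WithTop.top_add, top_le_iff] at hk
        exact absurd hk WithTop.coe_ne_top
      | coe n =>
        have hn : -1 ≤ n := by
          rcases hkc with ⟨-, h⟩ | ⟨-, h⟩ | ⟨n', h, hn', -⟩
          · exact absurd h WithTop.coe_ne_top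
          · exact (WithTop.coe_injective h).ge
          · rwa [WithTop.coe_injective h]
        rw [← WithTop.coe_add, WithTop.coe_le_coe] at hk
        refine ⟨k - 1, by omega, ?_⟩
        rw [← WithTop.coe_add, WithTop.coe_le_coe]
        omega
    obtain ⟨j, rfl, hj⟩ := hkc1
    have h := MultiPoint.nodalS_succ_of_J_le hl hr hrs hla hlb (MultiPoint.J_le_eigRD hl hkc hj)
    rwa [show ((j + 1 : ℕ) : ℤ) - 1 = j by push_cast; ring, MultiPoint.eigRDInt_natCast]
  · rintro rfl
    have hJ : ∀ k, r.J ≤ (MultiPoint.eigRD l k : EReal) := fun k =>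
      MultiPoint.J_le_eigRD hl hkc (by
        rw [← WithTop.coe_add, WithTop.coe_le_coe]; omega)
    have h0 := MultiPoint.nodalS_zero_of_J_le hl hr hrs hla hlb (hJ 0)
    refine ⟨h0.1, ?_, ?_, h0.2, fun k => ?_⟩
    · rw [MultiPoint.eig_eq hl hr hrs hla hlb]; exact sq_nonneg _
    · rw [MultiPoint.eig_eq hl hr hrs hla hlb, sq_eq_zero_iff,
        (MultiPoint.charData hl hr hrs).root_eq_zero_iff]
      exact and_iff_right rfl
    · cases k with
      | zero => exact h0.1
      | succ j => exact (MultiPoint.nodalS_succ_of_J_le hl hr hrs hla hlb (hJ j)).1
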